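/- An instance of \textsc{Token Sliding} is a tuple $(G,k,I_s,I_t)$ where $G$ is a finite simple graph and $I_s,I_t$ are independent sets of $G$ with $|I_s|=|I_t|=k$. It is a yes-instance if $I_s$ can be transformed into $I_t$ by a finite sequence of token slides (replacing a vertex $u$ of the current set by a vertex $v$ outside it with $uv\in E(G)$) such that every intermediate set is independent. Let $\Delta=\Delta(G)$ be the maximum degree of $G$. A galactic graph is a finite simple graph whose vertex set is partitioned into planets and black holes. A galactic independent set of size $k$ is a weight function $\omega:V\to\mathbb{N}$ of total weight $k$ with $\omega\le 1$ on planets and such that no two adjacent planets both have positive weight. An instance of \textsc{Galactic Token Sliding} consists of a galactic graph, an integer $k$ and two galactic independent sets of size $k$; it is a yes-instance if one can be transformed into the other by moving one unit of weight at a time along an edge, all intermediate weight functions being galactic independent sets of size $k$. Theorem. (i) \textsc{Token Sliding} is fixed-parameter tractable when parameterized by $k+\Delta$: there are a computable function $f$ and a polynomial $q$ such that every instance of encoding size $N$ can be decided in time $f(k+\Delta)\cdot q(N)$. (ii) \textsc{Token Sliding} parameterized by $k+\Delta$ admits a bikernel to \textsc{Galactic Token Sliding}, parameterized likewise by the number of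 tokens plus the maximum degree. That is, there are a constant $c$ and a polynomial-time computable map $r$ that sends each instance $(G,k,I_s,I_t)$ of \textsc{Token Sliding} to an instance of \textsc{Galactic Token Sliding}, with underlying graph $G'$ and $k'$ tokens, such that the two instances are equivalent, the encoding size and the parameter of the output are bounded by a computable function of $k+\Delta$, $k'\le k$, and, whenever $\Delta\ge 1$, $$|V(G')|\ \le\ k\,\Delta^{c k^2}+(2k+2k\Delta)\,\Delta .$$ Moreover, if $G$ is connected and $k\ge 2$, then $G'$ is connected and $k'\ge 2$. -/

import Mathlib

namespace TokenSliding

/-! ### A machine model with a cost measure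

Data are binary trees (S-expressions).  Programs are the one-variable structured `while` programs
over binary trees.  Every basic operation is charged one unit plus the size of the tree it is
applied to, so that the size of a result never exceeds the cost of computing it; this model and
multitape Turing machines simulate each other with polynomial overhead. -/

/-- Binary trees, the data on which programs work. -/
inductive SExp : Type
  | nil : SExp
  | node : SExp → SExp → SExp

namespace SExp

/-- Number of constructors of a tree. -/
def size : SExp → ℕ
  | nil => 1
  | node l r => l.size + r.size + 1

/-- Left subtree (`nil` for `nil`). -/
def left : SExp → SExp
  | nil => nil
  | node l _ => l

/-- Right subtree (`nil` for `nil`). -/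
def right : SExp → SExp
  | nil => nil
  | node _ r => r

/-- A list of trees, as a right comb. -/
def ofList : List SExp → SExp
  | [] => nil
  | a :: l => node a (ofList l)

/-- Truth values: `nil` is false. -/
def ofBool : Bool → SExp
  | false => nil
  | true => node nil nil

/-- Natural numbers in unary. -/
def ofNat (n : ℕ) : SExp := ofList (List.replicate n nil)

end SExp

/-- Programs; each one transforms one tree into one tree. -/
inductive Prog : Type
  /-- return the input -/
  | id : Prog
  /-- return `nil` -/
  | nil : Prog
  /-- return the left subtree of the input -/
  | left : Prog
  /-- return the right subtree of the input -/
  | right : Prog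
  /-- run both programs on the input and join the two results by a node -/
  | pair : Prog → Prog → Prog
  /-- `seq f g`: run `f`, then run `g` on its result -/
  | seq : Prog → Prog → Prog
  /-- `cond c f g`: if `c` returns a tree other than `nil` then run `f`, else run `g`, on the input -/
  | cond : Prog → Prog → Prog → Prog
  /-- `loop c f`: while `c` returns a tree other than `nil` on the current tree, replace
  the current tree by the result of `f` on it -/
  | loop : Prog → Prog → Prog

/-- `Runs p x y t`: on input `x` the program `p` halts with output `y`, at cost exactly `t`. -/
inductive Runs : Prog → SExp → SExp → ℕ → Prop
  | id (x : SExp) : Runs Prog.id x x (1 + x.size)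
  | nil (x : SExp) : Runs Prog.nil x SExp.nil (1 + x.size)
  | left (x : SExp) : Runs Prog.left x x.left (1 + x.size)
  | right (x : SExp) : Runs Prog.right x x.right (1 + x.size)
  | pair {f g : Prog} {x y z : SExp} {s t : ℕ} (hf : Runs f x y s) (hg : Runs g x z t) :
      Runs (Prog.pair f g) x (SExp.node y z) (s + t + (1 + x.size))
  | seq {f g : Prog} {x y z : SExp} {s t : ℕ} (hf : Runs f x y s) (hg : Runs g y z t) :
      Runs (Prog.seq f g) x z (s + t + 1)
  | cond_true {c f g : Prog} {x b y : SExp} {s t : ℕ} (hc : Runs c x b s) (hb : b ≠ SExp.nil)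
      (hf : Runs f x y t) : Runs (Prog.cond c f g) x y (s + t + (1 + x.size))
  | cond_false {c f g : Prog} {x y : SExp} {s t : ℕ} (hc : Runs c x SExp.nil s)
      (hg : Runs g x y t) : Runs (Prog.cond c f g) x y (s + t + (1 + x.size))
  | loop_stop {c f : Prog} {x : SExp} {s : ℕ} (hc : Runs c x SExp.nil s) :
      Runs (Prog.loop c f) x x (s + (1 + x.size))
  | loop_step {c f : Prog} {x b y z : SExp} {s t u : ℕ} (hc : Runs c x b s) (hb : b ≠ SExp.nil)
      (hf : Runs f x y t) (hl : Runs (Prog.loop c f) y z u) :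
      Runs (Prog.loop c f) x z (s + t + u + (1 + x.size))

/-! ### Parameterized problems -/

/-- A parameterized decision problem: instances, their encoding as trees, the parameter, and the
set of yes-instances. -/
structure ParamProblem where
  Inst : Type
  encode : Inst → SExp
  param : Inst → ℕ
  IsYes : Inst → Prop

open Classical in
/-- Fixed-parameter tractability: some program decides every instance `x` in time
`f (param x) * q (|x|)`, for a computable function `f` and a polynomial `q`. -/
def ParamProblem.IsFPT (P : ParamProblem) : Prop :=
  ∃ (p : Prog) (f : ℕ → ℕ) (q : Polynomial ℕ), Computable f ∧
    ∀ x : P.Inst, ∃ t : ℕ,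
      Runs p (P.encode x) (SExp.ofBool (decide (P.IsYes x))) t ∧
        t ≤ f (P.param x) * q.eval (P.encode x).size

/-- `r` is a bikernelization from `P` to `Q`: it is computable in polynomial time, preserves the
answer, and the size and the parameter of its output are bounded by a computable function of the
parameter of its input. -/
structure IsBikernelization (P Q : ParamProblem) (r : P.Inst → Q.Inst) : Prop where
  polytime : ∃ (p : Prog) (q : Polynomial ℕ), ∀ x : P.Inst, ∃ t : ℕ,
    Runs p (P.encode x) (Q.encode (r x)) t ∧ t ≤ q.eval (P.encode x).size
  equivalent : ∀ x : P.Inst, P.IsYes x ↔ Q.IsYes (r x)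
  bounded : ∃ g : ℕ → ℕ, Computable g ∧ ∀ x : P.Inst,
    (Q.encode (r x)).size ≤ g (P.param x) ∧ Q.param (r x) ≤ g (P.param x)

/-! ### Encodings of graphs and vertex sets -/

open Classical in
/-- The adjacency matrix of a graph, as a list of rows. -/
noncomputable def encodeGraph {n : ℕ} (G : SimpleGraph (Fin n)) : SExp :=
  SExp.ofList (List.ofFn fun i : Fin n =>
    SExp.ofList (List.ofFn fun j : Fin n => SExp.ofBool (decide (G.Adj i j))))

/-- The characteristic vector of a set of vertices. -/
def encodeSet {n : ℕ} (S : Finset (Fin n)) : SExp :=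
  SExp.ofList (List.ofFn fun i : Fin n => SExp.ofBool (decide (i ∈ S)))

/-- The list of values of a weight function, in unary. -/
def encodeWeights {n : ℕ} (w : Fin n → ℕ) : SExp :=
  SExp.ofList (List.ofFn fun i : Fin n => SExp.ofNat (w i))

open Classical in
/-- The maximum degree of a graph on `Fin n`. -/
noncomputable def maxDeg {n : ℕ} (G : SimpleGraph (Fin n)) : ℕ := G.maxDegree

/-! ### Token Sliding -/

/-- One token slide between independent sets: a token on `u ∈ I` slides along an edge `uv` to `v`. -/
def TSStep {n : ℕ} (G : SimpleGraph (Fin n)) (I J : Finset (Fin n)) : Prop :=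
  G.IsIndepSet (I : Set (Fin n)) ∧ G.IsIndepSet (J : Set (Fin n)) ∧
    ∃ u v : Fin n, u ∈ I ∧ v ∉ I ∧ G.Adj u v ∧ J = insert v (I.erase u)

/-- An instance `(G, k, I_s, I_t)` of Token Sliding. -/
structure TSInstance where
  n : ℕ
  G : SimpleGraph (Fin n)
  k : ℕ
  source : Finset (Fin n)
  target : Finset (Fin n)
  source_indep : G.IsIndepSet (source : Set (Fin n))
  target_indep : G.IsIndepSet (target : Set (Fin n))
  source_card : source.card = k
  target_card : target.card = k

/-- Token Sliding, parameterized by the number of tokens plus the maximum degree. -/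
noncomputable def tokenSliding : ParamProblem where
  Inst := TSInstance
  encode x := SExp.ofList
    [encodeGraph x.G, SExp.ofNat x.k, encodeSet x.source, encodeSet x.target]
  param x := x.k + maxDeg x.G
  IsYes x := Relation.ReflTransGen (TSStep x.G) x.source x.target

/-! ### Galactic Token Sliding -/

/-- A galactic independent set with `k` tokens in the galactic graph with underlying graph `G` and
set of black holes `B` (the other vertices are the planets), given by its weight function: planets
hold at most one token, no two adjacent planets hold tokens, and the total weight is `k`. -/
structure IsGalacticIndep {n : ℕ} (G : SimpleGraph (Fin n)) (B : Finset (Fin n)) (k : ℕ)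
    (w : Fin n → ℕ) : Prop where
  planet_le_one : ∀ v, v ∉ B → w v ≤ 1
  planet_indep : ∀ u v, u ∉ B → v ∉ B → G.Adj u v → w u = 0 ∨ w v = 0
  total : ∑ v, w v = k

/-- One token slide between galactic independent sets: `w'` arises from `w` by moving one token
from `u` to `v` along an edge `uv`. -/
def GalacticStep {n : ℕ} (G : SimpleGraph (Fin n)) (B : Finset (Fin n)) (k : ℕ)
    (w w' : Fin n → ℕ) : Prop :=
  IsGalacticIndep G B k w ∧ IsGalacticIndep G B k w' ∧
    ∃ u v : Fin n, G.Adj u v ∧ w' + Pi.single u 1 = w + Pi.single v 1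

/-- An instance `(G, k, I_s, I_t)` of Galactic Token Sliding. -/
structure GalacticInstance where
  n : ℕ
  G : SimpleGraph (Fin n)
  blackHoles : Finset (Fin n)
  k : ℕ
  source : Fin n → ℕ
  target : Fin n → ℕ
  source_indep : IsGalacticIndep G blackHoles k source
  target_indep : IsGalacticIndep G blackHoles k target

/-- Galactic Token Sliding, parameterized by the number of tokens plus the maximum degree. -/
noncomputable def galacticTokenSliding : ParamProblem where
  Inst := GalacticInstance
  encode x := SExp.ofList
    [encodeGraph x.G, encodeSet x.blackHoles, SExp.ofNat x.k,
      encodeWeights x.source, encodeWeights x.target]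
  param x := x.k + maxDeg x.G
  IsYes x := Relation.ReflTransGen (GalacticStep x.G x.blackHoles x.k) x.source x.target

end TokenSliding

/-!
The reduction keeps the part of the graph `G` close to the token set `S = I_s ∪ I_t` and contracts
what lies far away.  A component of `G` minus the ball of radius `2` around `S` is called deep if
it contains a vertex at distance exactly `2k + 6` from `S`.  Every deep component is contracted to
a black hole, the other vertices at finite distance from `S` stay planets, and the vertices at
infinite distance, which no token ever reaches, are dropped (`kernel`).  Each class has a
representative in the ball of radius `2k + 6`, so the number of vertices is at most
`2k (Δ + 1) ^ (2k + 6)` (`kernel_n_le`); for `Δ = 1` this ball is the ball of radius `1`.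

A token sliding sequence projects to a galactic one by counting the tokens in each class.  For
the converse (`Contraction.reach_of_galacticStep`), a shortest path from `S` into a deep component
provides vertices of that component at distances `4, …, 2k + 6` from `S`.  This path is induced,
no vertex outside the component is adjacent to it, and a vertex of the component is adjacent to at
most three consecutive vertices of it.  It serves as a store for the tokens in the black hole.
Tokens on planets next to a black hole are parked in the black hole at once, so that a token
walking inside a component meets only the tokens stored there; when it becomes adjacent to the
path, these make room and the token enters the path (`ClimbingPath.reach_absorb`).  As slides are
reversible, tokens also leave black holes in this way.

For the algorithmic part, `TC B f` says that some program computes `f` on codes within a time bound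
from a class `B` that is closed under sums, products and composition.  `TC B` is closed under
composition, left folds with small accumulators, and hence under the usual list operations and
under the computation of reachability by iterated images (`TC.iterImage`).  With polynomial bounds
this gives the kernel; with monotone computable bounds it gives an exhaustive search on galactic
instances.  The kernel followed by the search is a fixed-parameter algorithm.
-/

set_option linter.unusedSectionVars false

namespace TokenSliding

/-! ### Functions computed by programs within a class of time bounds -/

/-- Types whose elements are coded by trees.  The instances follow the encodings of the problem
instances; in particular, numbers are coded in unary. -/
class Enc (α : Type) where
  /-- The code of an element. -/
  enc : α → SExp

open Enc

instance : Enc Unit := ⟨fun _ => SExp.nil⟩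
instance : Enc Bool := ⟨SExp.ofBool⟩
instance : Enc ℕ := ⟨SExp.ofNat⟩
instance {α β : Type} [Enc α] [Enc β] : Enc (α × β) := ⟨fun p => SExp.node (enc p.1) (enc p.2)⟩
instance {α : Type} [Enc α] : Enc (List α) := ⟨fun l => SExp.ofList (l.map enc)⟩

/-- Size of the code of an element. -/
def esize {α : Type} [Enc α] (a : α) : ℕ := (enc a).size

section Sizes

variable {α β : Type} [Enc α] [Enc β]

theorem enc_pair (a : α) (b : β) : enc (a, b) = SExp.node (enc a) (enc b) := rfl
theorem enc_nil : enc ([] : List α) = SExp.nil := rfl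
theorem enc_cons (a : α) (l : List α) : enc (a :: l) = SExp.node (enc a) (enc l) := rfl
theorem enc_zero : enc (0 : ℕ) = SExp.nil := rfl
theorem enc_succ (n : ℕ) : enc (n + 1) = SExp.node SExp.nil (enc n) := rfl

theorem enc_replicate (n : ℕ) : enc (List.replicate n ()) = enc n := by
  induction n with
  | zero => rfl
  | succ n ih => rw [List.replicate_succ, enc_cons, ih]; rfl

@[simp] theorem esize_pair (a : α) (b : β) : esize (a, b) = esize a + esize b + 1 := rfl
@[simp] theorem esize_nil : esize ([] : List α) = 1 := rfl
@[simp] theorem esize_cons (a : α) (l : List α) : esize (a :: l) = esize a + esize l + 1 := rfl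

@[simp] theorem esize_nat (n : ℕ) : esize n = 2 * n + 1 := by
  induction n with
  | zero => rfl
  | succ n ih => simp only [esize, enc_succ, SExp.size] at *; omega

theorem esize_bool_le (b : Bool) : esize b ≤ 3 := by
  cases b <;> simp [esize, enc, SExp.ofBool, SExp.size]

theorem esize_append (l m : List α) : esize (l ++ m) + 1 = esize l + esize m := by
  induction l with
  | nil => simp; omega
  | cons a l ih => simp only [List.cons_append, esize_cons]; omega

theorem esize_reverse (l : List α) : esize l.reverse = esize l := by
  induction l with
  | nil => rfl
  | cons a l ih =>
    have := esize_append l.reverse [a]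
    simp only [List.reverse_cons, esize_cons, esize_nil] at *; omega

theorem esize_sublist {l m : List α} (h : l.Sublist m) : esize l ≤ esize m := by
  induction h with
  | slnil => exact le_rfl
  | cons a _ ih => simp only [esize_cons]; omega
  | cons_cons a _ ih => simp only [esize_cons]; omega

theorem length_le_esize (l : List α) : l.length + 1 ≤ esize l := by
  induction l with
  | nil => simp
  | cons a l ih => simp only [List.length_cons, esize_cons]; omega

theorem esize_mem {a : α} {l : List α} (h : a ∈ l) : esize a + 1 ≤ esize l := by
  have := esize_sublist (List.singleton_sublist.2 h)
  simp only [esize_cons, esize_nil] at this; omega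

theorem esize_le_of_forall (l : List α) (K : ℕ) (h : ∀ a ∈ l, esize a ≤ K) :
    esize l ≤ l.length * (K + 1) + 1 := by
  induction l with
  | nil => simp
  | cons a l ih =>
    have h1 := h a (by simp)
    have h2 := ih fun b hb => h b (by simp [hb])
    simp only [esize_cons, List.length_cons, Nat.add_mul]; omega

theorem esize_flatMap_le (l : List α) (g : α → List β) (K : ℕ) (h : ∀ a ∈ l, esize (g a) ≤ K) :
    esize (l.flatMap g) ≤ l.length * K + 1 := by
  induction l with
  | nil => simp
  | cons a l ih =>
    have h1 := h a (by simp)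
    have h2 := ih fun b hb => h b (by simp [hb])
    have h3 := esize_append (g a) (l.flatMap g)
    simp only [List.flatMap_cons, List.length_cons, Nat.add_mul]; omega

end Sizes

/-- Every result is paid for: its size is at most the cost of computing it. -/
theorem Runs.size_le {p : Prog} {x y : SExp} {t : ℕ} (h : Runs p x y t) : y.size ≤ t := by
  induction h with
  | left x => cases x <;> simp [SExp.left, SExp.size]; omega
  | right x => cases x <;> simp [SExp.right, SExp.size]; omega
  | nil x => simp [SExp.size]
  | pair _ _ ih1 ih2 => simp only [SExp.size]; omega
  | _ => omega

/-- Classes of monotone bounds that are closed under the operations by which the costs of composed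
programs are estimated.  Polynomials form one such class, the monotone computable functions
another; the closure properties of `TC` below hold for both. -/
class BoundClass (B : Set (ℕ → ℕ)) : Prop where
  mono : ∀ f ∈ B, Monotone f
  id_mem : (fun n => n) ∈ B
  const_mem : ∀ c : ℕ, (fun _ => c) ∈ B
  add_mem : ∀ f ∈ B, ∀ g ∈ B, (fun n => f n + g n) ∈ B
  mul_mem : ∀ f ∈ B, ∀ g ∈ B, (fun n => f n * g n) ∈ B
  comp_mem : ∀ f ∈ B, ∀ g ∈ B, (fun n => f (g n)) ∈ B

/-- `TC B f`: some program computes `f` on codes, in time bounded by a function of the class `B`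
in the size of the input. -/
def TC (B : Set (ℕ → ℕ)) {α β : Type} [Enc α] [Enc β] (f : α → β) : Prop :=
  ∃ p : Prog, ∃ b ∈ B, ∀ a, ∃ t, Runs p (enc a) (enc (f a)) t ∧ t ≤ b (esize a)

namespace TC

open BoundClass

variable {B : Set (ℕ → ℕ)} [BoundClass B]
variable {α β γ σ τ : Type} [Enc α] [Enc β] [Enc γ] [Enc σ] [Enc τ]

theorem out_size {f : α → β} (hf : TC B f) : ∃ b ∈ B, ∀ a, esize (f a) ≤ b (esize a) := by
  obtain ⟨p, b, hb, h⟩ := hf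
  refine ⟨b, hb, fun a => ?_⟩
  obtain ⟨t, ht, hle⟩ := h a
  exact ht.size_le.trans hle

theorem linear_mem (c d : ℕ) : (fun n => c * n + d) ∈ B :=
  add_mem _ (mul_mem _ (const_mem c) _ id_mem) _ (const_mem d)

/-- A function whose code is computed by a constant-cost basic operation. -/
theorem of_basic {f : α → β} (p : Prog) (h : ∀ a, Runs p (enc a) (enc (f a)) (1 + esize a)) :
    TC B f :=
  ⟨p, _, linear_mem 1 1, fun a => ⟨_, h a, (by omega : 1 + esize a ≤ 1 * esize a + 1)⟩⟩

theorem id : TC B (fun a : α => a) := of_basic Prog.id fun _ => Runs.id _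

theorem fst : TC B (fun a : α × β => a.1) := of_basic Prog.left fun a => Runs.left (enc a)

theorem snd : TC B (fun a : α × β => a.2) := of_basic Prog.right fun a => Runs.right (enc a)

theorem const (c : β) : TC B (fun _ : α => c) := by
  have key : ∀ y : SExp, ∃ p : Prog, ∃ b ∈ B, ∀ x : SExp, ∃ t, Runs p x y t ∧ t ≤ b x.size := by
    intro y
    induction y with
    | nil => exact ⟨Prog.nil, _, linear_mem 1 1, fun x => ⟨_, Runs.nil x, by omega⟩⟩
    | node l r ihl ihr =>
      obtain ⟨p, b, hb, hp⟩ := ihl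
      obtain ⟨q, d, hd, hq⟩ := ihr
      refine ⟨Prog.pair p q, _, add_mem _ (add_mem _ hb _ hd) _ (linear_mem 1 1), fun x => ?_⟩
      obtain ⟨s, hs, hs'⟩ := hp x
      obtain ⟨t, ht, ht'⟩ := hq x
      exact ⟨_, Runs.pair hs ht, by omega⟩
  obtain ⟨p, b, hb, h⟩ := key (enc c)
  exact ⟨p, b, hb, fun a => h (enc a)⟩

theorem comp {g : β → γ} {f : α → β} (hg : TC B g) (hf : TC B f) : TC B (fun a => g (f a)) := by
  obtain ⟨p, b, hb, hp⟩ := hf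
  obtain ⟨q, d, hd, hq⟩ := hg
  refine ⟨Prog.seq p q, _, add_mem _ (add_mem _ hb _ (comp_mem _ hd _ hb)) _ (const_mem 1),
    fun a => ?_⟩
  obtain ⟨s, hs, hs'⟩ := hp a
  obtain ⟨t, ht, ht'⟩ := hq (f a)
  refine ⟨_, Runs.seq hs ht, ?_⟩
  have := mono _ hd (hs.size_le.trans hs')
  dsimp only [esize] at *; omega

theorem pair {f : α → β} {g : α → γ} (hf : TC B f) (hg : TC B g) : TC B (fun a => (f a, g a)) := by
  obtain ⟨p, b, hb, hp⟩ := hf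
  obtain ⟨q, d, hd, hq⟩ := hg
  refine ⟨Prog.pair p q, _, add_mem _ (add_mem _ hb _ hd) _ (linear_mem 1 1), fun a => ?_⟩
  obtain ⟨s, hs, hs'⟩ := hp a
  obtain ⟨t, ht, ht'⟩ := hq a
  exact ⟨_, Runs.pair hs ht, by dsimp only [esize] at *; omega⟩

/-- Branching on whether the code of `c a` is `nil`. -/
theorem branch {c : α → σ} {f : α → β} {P : α → Prop} [DecidablePred P] {g : α → β}
    (hc : TC B c) (hP : ∀ a, P a ↔ enc (c a) ≠ SExp.nil) (hf : TC B f) (hg : TC B g) :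
    TC B (fun a => if P a then f a else g a) := by
  obtain ⟨p, b, hb, hp⟩ := hf
  obtain ⟨q, d, hd, hq⟩ := hg
  obtain ⟨r, e, he, hr⟩ := hc
  refine ⟨Prog.cond r p q, _,
    add_mem _ (add_mem _ he _ (add_mem _ hb _ hd)) _ (linear_mem 1 1), fun a => ?_⟩
  obtain ⟨s, hs, hs'⟩ := hp a
  obtain ⟨t, ht, ht'⟩ := hq a
  obtain ⟨u, hu, hu'⟩ := hr a
  beta_reduce
  by_cases h : P a
  · rw [if_pos h]
    exact ⟨_, Runs.cond_true hu ((hP a).1 h) hs, by simp only [esize] at *; omega⟩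
  · rw [if_neg h]
    have h0 : enc (c a) = SExp.nil := by by_contra h'; exact h ((hP a).2 h')
    rw [h0] at hu
    exact ⟨_, Runs.cond_false hu ht, by simp only [esize] at *; omega⟩

theorem ite {c : α → Bool} {f g : α → β} (hc : TC B c) (hf : TC B f) (hg : TC B g) :
    TC B (fun a => if c a then f a else g a) :=
  branch hc (fun a => by cases c a <;> simp [enc, SExp.ofBool]) hf hg

theorem and {c d : α → Bool} (hc : TC B c) (hd : TC B d) : TC B (fun a => c a && d a) := by
  convert ite hc hd (const (B := B) false) using 2 with a
  cases c a <;> simp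

theorem or {c d : α → Bool} (hc : TC B c) (hd : TC B d) : TC B (fun a => c a || d a) := by
  convert ite hc (const (B := B) true) hd using 2 with a
  cases c a <;> simp

theorem not {c : α → Bool} (hc : TC B c) : TC B (fun a => !c a) := by
  convert ite hc (const (B := B) false) (const (B := B) true) using 2 with a
  cases c a <;> simp

theorem congr_enc {f : α → β} {g : α → γ} (hf : TC B f) (h : ∀ a, enc (f a) = enc (g a)) :
    TC B g := by
  obtain ⟨p, b, hb, hp⟩ := hf
  exact ⟨p, b, hb, fun a => by rw [← h a]; exact hp a⟩

/-! ### Lists -/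

theorem cons {f : α → β} {g : α → List β} (hf : TC B f) (hg : TC B g) :
    TC B (fun a => f a :: g a) :=
  congr_enc (pair hf hg) fun _ => rfl

theorem tail {f : α → List β} (hf : TC B f) : TC B (fun a => (f a).tail) :=
  comp (of_basic Prog.right fun l => by
    have h : enc l.tail = (enc l).right := by cases l <;> rfl
    rw [h]; exact Runs.right _) hf

theorem headD {f : α → List β} {d : α → β} (hf : TC B f) (hd : TC B d) :
    TC B (fun a => (f a).headD (d a)) := by
  -- the left subtree of the code of a nonempty list is the code of its head
  obtain ⟨p, b, hb, hp⟩ := hf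
  obtain ⟨q, e, he, hq⟩ := hd
  refine ⟨Prog.cond p (Prog.seq p Prog.left) q, _, add_mem _ (add_mem _
    (mul_mem _ (const_mem 3) _ hb) _ he) _ (linear_mem 1 3), fun a => ?_⟩
  obtain ⟨s, hs, hs'⟩ := hp a
  obtain ⟨t, ht, ht'⟩ := hq a
  have h1 := hs.size_le
  beta_reduce
  cases h : f a with
  | nil =>
    rw [h] at hs
    exact ⟨_, Runs.cond_false hs ht, by simp only [esize] at *; omega⟩
  | cons x l =>
    rw [h] at hs h1
    exact ⟨_, Runs.cond_true hs (by simp [enc_cons]) (Runs.seq hs (Runs.left _)),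
      by simp only [esize] at *; omega⟩

theorem isEmpty {f : α → List β} (hf : TC B f) : TC B (fun a => (f a).isEmpty) := by
  convert branch (P := fun a => f a ≠ []) hf
    (fun a => by cases f a <;> simp [enc_nil, enc_cons]) (const false) (const true) using 2 with a
  cases f a <;> simp

/-- Cost of the loop that implements a left fold.  The current tree codes the environment, the rest
of the list and the accumulator; `Z` bounds its size throughout. -/
theorem runs_fold_loop {step : α → σ → τ → σ} {p : Prog} {b : ℕ → ℕ} (hb : Monotone b)
    (hp : ∀ x : α × σ × τ, ∃ t, Runs p (enc x) (enc (step x.1 x.2.1 x.2.2)) t ∧ t ≤ b (esize x))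
    (a : α) (Z : ℕ) : ∀ (l : List τ) (s : σ),
    (∀ l', l' <+: l → esize a + esize l + esize (l'.foldl (step a) s) + 2 ≤ Z) →
    ∃ t, Runs (Prog.loop (Prog.seq Prog.right Prog.left)
      (Prog.pair Prog.left (Prog.pair (Prog.seq Prog.right (Prog.seq Prog.left Prog.right))
        (Prog.seq (Prog.pair Prog.left (Prog.pair (Prog.seq Prog.right Prog.right)
          (Prog.seq Prog.right (Prog.seq Prog.left Prog.left)))) p))))
      (enc (a, l, s)) (enc (a, ([] : List τ), l.foldl (step a) s)) t ∧
      t ≤ (l.length + 1) * (b Z + 20 * (Z + 1)) := by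
  intro l
  induction l with
  | nil =>
    intro s hZ
    have h0 := hZ [] (by simp)
    refine ⟨_, Runs.loop_stop (Runs.seq (Runs.right _) (Runs.left _)), ?_⟩
    simp only [List.foldl_nil, esize, enc_pair, enc_nil, SExp.size, SExp.right, List.length_nil]
      at *
    omega
  | cons x l ih =>
    intro s hZ
    have h0 := hZ [] (by simp)
    have h1 := hZ [x] (by simp)
    obtain ⟨u, hu, hu'⟩ := ih (step a s x) (fun l' hl' => by
      have := hZ (x :: l') (by simpa using hl')
      simp only [List.foldl_cons, esize_cons] at this ⊢
      omega)
    obtain ⟨v, hv, hv'⟩ := hp (a, s, x)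
    have hbZ : b (esize (a, s, x)) ≤ b Z := hb (by
      simp only [List.foldl_nil, esize_cons, esize_pair] at h0 ⊢; omega)
    refine ⟨_, Runs.loop_step (Runs.seq (Runs.right _) (Runs.left _)) ?_
      (Runs.pair (Runs.left _) (Runs.pair (Runs.seq (Runs.right _)
        (Runs.seq (Runs.left _) (Runs.right _))) (Runs.seq (Runs.pair (Runs.left _)
        (Runs.pair (Runs.seq (Runs.right _) (Runs.right _))
          (Runs.seq (Runs.right _) (Runs.seq (Runs.left _) (Runs.left _))))) hv))) hu, ?_⟩
    · simp [enc_pair, enc_cons, SExp.right, SExp.left]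
    · simp only [List.foldl_nil, List.foldl_cons, esize, enc_pair, enc_cons, SExp.size,
        SExp.right, SExp.left, List.length_cons] at *
      rw [Nat.add_mul (l.length + 1) 1]
      omega

/-- Left folds, provided that the accumulators stay small. -/
theorem foldl {l : α → List τ} {init : α → σ} {step : α → σ → τ → σ} (hl : TC B l)
    (hi : TC B init) (hs : TC B (fun x : α × σ × τ => step x.1 x.2.1 x.2.2)) {b : ℕ → ℕ}
    (hb : b ∈ B) (hsize : ∀ a l', l' <+: l a → esize (l'.foldl (step a) (init a)) ≤ b (esize a)) :
    TC B (fun a => (l a).foldl (step a) (init a)) := by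
  obtain ⟨bl, hbl, hbl'⟩ := out_size hl
  obtain ⟨p, bp, hbp, hp⟩ := hs
  have hZ : (fun n => n + bl n + b n + 2) ∈ B :=
    add_mem _ (add_mem _ (add_mem _ id_mem _ hbl) _ hb) _ (const_mem 2)
  obtain ⟨q, d, hd, hq⟩ : TC B (fun a => (a, l a, init a)) := pair id (pair hl hi)
  refine ⟨Prog.seq q (Prog.seq (Prog.loop (Prog.seq Prog.right Prog.left)
      (Prog.pair Prog.left (Prog.pair (Prog.seq Prog.right (Prog.seq Prog.left Prog.right))
        (Prog.seq (Prog.pair Prog.left (Prog.pair (Prog.seq Prog.right Prog.right)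
          (Prog.seq Prog.right (Prog.seq Prog.left Prog.left)))) p))))
      (Prog.seq Prog.right Prog.right)), _,
    add_mem _ hd _ (mul_mem _ (add_mem _ hbl _ (const_mem 1)) _ (add_mem _ (comp_mem _ hbp _ hZ) _
      (mul_mem _ (const_mem 25) _ (add_mem _ hZ _ (const_mem 1))))), fun a => ?_⟩
  obtain ⟨s, hs, hs'⟩ := hq a
  have hla := hbl' a
  have hlen := length_le_esize (l a)
  have hres := hsize a (l a) (List.prefix_refl _)
  obtain ⟨t, ht, ht'⟩ := runs_fold_loop (mono _ hbp) hp a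
    (esize a + bl (esize a) + b (esize a) + 2) (l a) (init a) (fun l' hl' => by
      have := hsize a l' hl'; omega)
  refine ⟨_, Runs.seq hs (Runs.seq ht (Runs.seq (Runs.right _) (Runs.right _))), ?_⟩
  set Z := esize a + bl (esize a) + b (esize a) + 2 with hZdef
  have h1 : (enc (a, ([] : List τ), (l a).foldl (step a) (init a))).size ≤ Z + 1 := by
    simp only [enc_pair, enc_nil, SExp.size]
    simp only [esize] at *; omega
  have h2 : (enc (a, ([] : List τ), (l a).foldl (step a) (init a))).right.size ≤ Z + 1 := by
    simp only [enc_pair, enc_nil, SExp.size, SExp.right]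
    simp only [esize] at *; omega
  have h3 : ((l a).length + 1) * (bp Z + 20 * (Z + 1)) + 5 * (Z + 1) ≤
      (bl (esize a) + 1) * (bp Z + 25 * (Z + 1)) := by
    calc _ ≤ ((l a).length + 1) * (bp Z + 20 * (Z + 1)) + ((l a).length + 1) * (5 * (Z + 1)) := by
            exact Nat.add_le_add_left (Nat.le_mul_of_pos_left _ (Nat.succ_pos _)) _
      _ = ((l a).length + 1) * (bp Z + 25 * (Z + 1)) := by ring
      _ ≤ _ := by gcongr; omega
  change _ ≤ d (esize a) + (bl (esize a) + 1) * (bp Z + 25 * (Z + 1))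
  omega

theorem foldl_cons_eq (l acc : List β) :
    l.foldl (fun s x => x :: s) acc = l.reverse ++ acc := by
  induction l generalizing acc with
  | nil => simp
  | cons a l ih => simp [ih]

theorem reverse {f : α → List β} (hf : TC B f) : TC B (fun a => (f a).reverse) := by
  refine comp (β := List β) (g := List.reverse) ?_ hf
  convert foldl (B := B) (α := List β) (l := fun l => l) (init := fun _ => [])
    (step := fun _ s x => x :: s) id (const []) (cons (snd.comp snd) (fst.comp snd)) id_mem ?_
    using 2 with l
  · simp
  · intro a l' hl'
    rw [foldl_cons_eq, List.append_nil, esize_reverse]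
    exact esize_sublist hl'.sublist

theorem append {f g : α → List β} (hf : TC B f) (hg : TC B g) : TC B (fun a => f a ++ g a) := by
  have h : TC B (fun x : List β × List β => x.1 ++ x.2) := by
    convert foldl (B := B) (α := List β × List β) (l := fun x => x.1.reverse) (init := fun x => x.2)
      (step := fun _ s x => x :: s) (reverse fst)
      snd (cons (snd.comp snd) (fst.comp snd)) id_mem ?_ using 2 with l
    · simp
    · rintro ⟨a, c⟩ l' hl'
      rw [foldl_cons_eq]
      have h1 := esize_append l'.reverse c
      have h2 := esize_sublist hl'.sublist
      rw [esize_reverse] at h1 h2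
      simp only [esize_pair] at *; omega
  exact comp (g := fun x : List β × List β => x.1 ++ x.2) h (pair hf hg)

theorem flatMap {f : α → List β} {g : α → β → List γ} (hf : TC B f)
    (hg : TC B (fun x : α × β => g x.1 x.2)) : TC B (fun a => (f a).flatMap (g a)) := by
  obtain ⟨bf, hbf, hbf'⟩ := out_size hf
  obtain ⟨bg, hbg, hbg'⟩ := out_size hg
  have key : ∀ (h : β → List γ) (l : List β) (acc : List γ),
      l.foldl (fun s x => s ++ h x) acc = acc ++ l.flatMap h := by
    intro h l
    induction l with
    | nil => simp
    | cons a l ih => intro acc; simp [ih]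
  have hZ : (fun n => n + bf n + 1) ∈ B := add_mem _ (add_mem _ id_mem _ hbf) _ (const_mem 1)
  convert foldl (B := B) (l := f) (init := fun _ => []) (step := fun a s x => s ++ g a x) hf
    (const []) (append (fst.comp snd) (hg.comp (pair fst (snd.comp snd))))
    (add_mem _ (mul_mem _ hbf _ (comp_mem _ hbg _ hZ)) _ (const_mem 1)) ?_ using 2 with a
  · simp [key]
  · intro a l' hl'
    rw [key, List.nil_append]
    have h1 := hbf' a
    have h2 := length_le_esize l'
    have h3 := esize_sublist hl'.sublist
    refine (esize_flatMap_le l' (g a) (bg (esize a + bf (esize a) + 1)) fun x hx => ?_).trans ?_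
    · refine (hbg' (a, x)).trans (mono _ hbg ?_)
      have := esize_mem hx
      simp only [esize_pair]; omega
    · gcongr
      omega

theorem map {f : α → List β} {g : α → β → γ} (hf : TC B f)
    (hg : TC B (fun x : α × β => g x.1 x.2)) : TC B (fun a => (f a).map (g a)) := by
  convert flatMap (g := fun a b => [g a b]) hf (cons hg (const [])) using 2 with a
  induction f a with
  | nil => rfl
  | cons x l ih => simp [ih]

theorem filter {f : α → List β} {p : α → β → Bool} (hf : TC B f)
    (hp : TC B (fun x : α × β => p x.1 x.2)) : TC B (fun a => (f a).filter (p a)) := by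
  convert flatMap (g := fun a b => if p a b then [b] else []) hf
    (ite hp (cons snd (const [])) (const [])) using 2 with a
  induction f a with
  | nil => rfl
  | cons x l ih => cases h : p a x <;> simp [ih, h]

theorem any {f : α → List β} {p : α → β → Bool} (hf : TC B f)
    (hp : TC B (fun x : α × β => p x.1 x.2)) : TC B (fun a => (f a).any (p a)) := by
  convert not (isEmpty (filter hf hp)) using 2 with a
  induction f a with
  | nil => rfl
  | cons x l ih => cases h : p a x <;> simp [ih, h]

theorem all {f : α → List β} {p : α → β → Bool} (hf : TC B f)
    (hp : TC B (fun x : α × β => p x.1 x.2)) : TC B (fun a => (f a).all (p a)) := by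
  convert not (any (p := fun a b => !p a b) hf (not hp)) using 2 with a
  induction f a with
  | nil => rfl
  | cons x l ih => cases h : p a x <;> simp [ih, h]

/-! ### Numbers -/

theorem succ {f : α → ℕ} (hf : TC B f) : TC B (fun a => f a + 1) :=
  congr_enc (pair (const ()) hf) fun _ => rfl

theorem length {f : α → List β} (hf : TC B f) : TC B (fun a => (f a).length) :=
  congr_enc (map hf (const ())) fun a => by rw [List.map_const', enc_replicate]

/-- Iteration, provided that the iterates stay small. -/
theorem iterate {n : α → ℕ} {init : α → σ} {F : α → σ → σ} (hn : TC B n) (hi : TC B init)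
    (hF : TC B (fun x : α × σ => F x.1 x.2)) {b : ℕ → ℕ} (hb : b ∈ B)
    (hsize : ∀ a, ∀ i ≤ n a, esize ((F a)^[i] (init a)) ≤ b (esize a)) :
    TC B (fun a => (F a)^[n a] (init a)) := by
  have key : ∀ (G : σ → σ) (i : ℕ) (s : σ),
      (List.replicate i ()).foldl (fun s _ => G s) s = G^[i] s := by
    intro G i
    induction i with
    | zero => intro s; rfl
    | succ i ih => intro s; simp [List.replicate_succ, ih]
  convert foldl (B := B) (l := fun a => List.replicate (n a) ()) (init := init)
    (step := fun a s _ => F a s) (congr_enc hn fun a => (enc_replicate _).symm) hi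
    (hF.comp (pair fst (fst.comp snd))) hb ?_ using 2 with a
  · rw [key]
  · intro a l' hl'
    have hl : l' = List.replicate l'.length () := by
      simp [List.eq_replicate_iff]
    rw [hl, key]
    exact hsize a _ (by simpa using hl'.length_le)

theorem pred {f : α → ℕ} (hf : TC B f) : TC B (fun a => f a - 1) :=
  comp (g := fun n : ℕ => n - 1) (of_basic Prog.right fun n => by
    have h : enc (n - 1) = (enc n).right := by cases n <;> rfl
    rw [h]; exact Runs.right _) hf

theorem sub {f g : α → ℕ} (hf : TC B f) (hg : TC B g) : TC B (fun a => f a - g a) := by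
  obtain ⟨bf, hbf, hbf'⟩ := out_size hf
  have key : ∀ m n : ℕ, (fun x => x - 1)^[n] m = m - n := by
    intro m n
    induction n with
    | zero => rfl
    | succ n ih => rw [Function.iterate_succ_apply', ih]; omega
  convert iterate (F := fun _ x => x - 1) hg hf (pred snd) hbf ?_ using 2 with a
  · rw [key]
  · intro a i _
    rw [key]
    have := hbf' a
    simp only [esize_nat] at *; omega

theorem isZero {f : α → ℕ} (hf : TC B f) : TC B (fun a => decide (f a = 0)) := by
  convert branch (P := fun a => f a ≠ 0) hf
    (fun a => by cases f a <;> simp [enc_zero, enc_succ]) (const false) (const true) using 2 with a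
  by_cases h : f a = 0 <;> simp [h]

theorem natLe {f g : α → ℕ} (hf : TC B f) (hg : TC B g) : TC B (fun a => decide (f a ≤ g a)) := by
  convert isZero (sub hf hg) using 3 with a
  omega

theorem natEq {f g : α → ℕ} (hf : TC B f) (hg : TC B g) : TC B (fun a => decide (f a = g a)) := by
  convert and (natLe hf hg) (natLe hg hf) using 2 with a
  rw [← Bool.decide_and]
  congr 1
  simp [le_antisymm_iff]

theorem getD {f : α → List β} {i : α → ℕ} {d : α → β} (hf : TC B f) (hi : TC B i) (hd : TC B d) :
    TC B (fun a => (f a).getD (i a) (d a)) := by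
  have key : ∀ (l : List β) (n : ℕ), List.tail^[n] l = l.drop n := by
    intro l n
    induction n generalizing l with
    | zero => rfl
    | succ n ih => rw [Function.iterate_succ_apply, ih]; cases l <;> simp
  obtain ⟨bf, hbf, hbf'⟩ := out_size hf
  have h : TC B (fun a => (List.tail^[i a] (f a))) :=
    iterate (F := fun _ l => List.tail l) hi hf (tail snd) hbf fun a j _ => by
      rw [key]
      exact (esize_sublist (List.drop_sublist _ _)).trans (hbf' a)
  convert headD h hd using 2 with a
  rw [key]
  generalize f a = l
  generalize i a = n
  induction n generalizing l with
  | zero => cases l <;> rfl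
  | succ n ih => cases l with
    | nil => rfl
    | cons x l => simpa only [List.drop_succ_cons, List.getD_cons_succ] using ih l

theorem range {f : α → ℕ} (hf : TC B f) : TC B (fun a => List.range (f a)) := by
  obtain ⟨bf, hbf, hbf'⟩ := out_size hf
  have key : ∀ n : ℕ, (fun l : List ℕ => 0 :: l.map (fun x => x + 1))^[n] [] = List.range n := by
    intro n
    induction n with
    | zero => rfl
    | succ n ih => rw [Function.iterate_succ_apply', ih, List.range_succ_eq_map]
  convert iterate (F := fun _ l => 0 :: List.map (fun x => x + 1) l) (init := fun _ => []) hf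
    (const []) (cons (const 0) (map snd (succ snd)))
    (add_mem _ (mul_mem _ hbf _ (add_mem _ hbf _ (const_mem 1))) _ (const_mem 1)) ?_ using 2 with a
  · rw [key]
  · intro a i hi
    rw [key]
    have h1 := hbf' a
    simp only [esize_nat] at h1
    refine (esize_le_of_forall _ (2 * i) fun x hx => ?_).trans ?_
    · rw [List.mem_range] at hx
      rw [esize_nat]; omega
    · rw [List.length_range]
      gcongr <;> omega

end TC

/-! ### Polynomial bounds and computable bounds -/

/-- The functions given by polynomials. -/
def PolyBd : Set (ℕ → ℕ) := {f | ∃ q : Polynomial ℕ, ∀ n, f n = q.eval n}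

/-- The monotone computable functions. -/
def CompBd : Set (ℕ → ℕ) := {f | Monotone f ∧ Computable f}

theorem eval_mono (q : Polynomial ℕ) : Monotone fun n => q.eval n := by
  induction q using Polynomial.induction_on' with
  | add p q hp hq => simpa only [Polynomial.eval_add] using hp.add hq
  | monomial n a =>
    intro x y h
    simp only [Polynomial.eval_monomial]
    gcongr

instance : BoundClass PolyBd where
  mono := by
    rintro f ⟨q, hq⟩
    rw [funext hq]
    exact eval_mono q
  id_mem := ⟨Polynomial.X, by simp⟩
  const_mem c := ⟨Polynomial.C c, by simp⟩
  add_mem := by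
    rintro f ⟨p, hp⟩ g ⟨q, hq⟩
    exact ⟨p + q, by simp [hp, hq]⟩
  mul_mem := by
    rintro f ⟨p, hp⟩ g ⟨q, hq⟩
    exact ⟨p * q, by simp [hp, hq]⟩
  comp_mem := by
    rintro f ⟨p, hp⟩ g ⟨q, hq⟩
    exact ⟨p.comp q, by simp [hp, hq, Polynomial.eval_comp]⟩

instance : BoundClass CompBd where
  mono f hf := hf.1
  id_mem := ⟨monotone_id, Computable.id⟩
  const_mem c := ⟨monotone_const, Computable.const c⟩
  add_mem := by
    rintro f ⟨hf, hf'⟩ g ⟨hg, hg'⟩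
    exact ⟨hf.add hg, Primrec.nat_add.to_comp.comp hf' hg'⟩
  mul_mem := by
    rintro f ⟨hf, hf'⟩ g ⟨hg, hg'⟩
    exact ⟨hf.mul' hg, Primrec.nat_mul.to_comp.comp hf' hg'⟩
  comp_mem := by
    rintro f ⟨hf, hf'⟩ g ⟨hg, hg'⟩
    exact ⟨hf.comp hg, hf'.comp hg'⟩

theorem compBd_pow {f g : ℕ → ℕ} (hf : f ∈ CompBd) (hg : g ∈ CompBd) :
    (fun n => (f n + 1) ^ g n) ∈ CompBd := by
  have hpow : Primrec₂ fun a b : ℕ => a ^ b := by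
    have h : Primrec₂ fun a b : ℕ => Nat.rec (motive := fun _ => ℕ) 1 (fun _ r => r * a) b :=
      Primrec.nat_rec (Primrec.const 1)
        (Primrec.nat_mul.comp (Primrec.snd.comp Primrec.snd) Primrec.fst).to₂
    refine h.of_eq fun a b => ?_
    induction b with
    | zero => rfl
    | succ b ih => rw [pow_succ, ← ih]
  refine ⟨fun m n h => ?_, hpow.to_comp.comp (Primrec.succ.to_comp.comp hf.2) hg.2⟩
  dsimp only
  calc (f m + 1) ^ g m ≤ (f m + 1) ^ g n := Nat.pow_le_pow_right (Nat.succ_pos _) (hg.1 h)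
    _ ≤ _ := Nat.pow_le_pow_left (Nat.succ_le_succ (hf.1 h)) _

/-! ### Iterated images of a relation -/

section IterImage

variable {α : Type}

/-- The members of `univ` that `R` relates to some member of `X`. -/
def relImage (R : α → α → Bool) (univ X : List α) : List α :=
  univ.filter fun x => X.any fun y => R y x

/-- The `i`-fold image of `init` under `R` within `univ`. -/
def iterImage (R : α → α → Bool) (univ : List α) (i : ℕ) (init : List α) : List α :=
  (relImage R univ)^[i] init

theorem mem_iterImage_succ {R : α → α → Bool} {univ init : List α} {i : ℕ} {x : α} :
    x ∈ iterImage R univ (i + 1) init ↔ x ∈ univ ∧ ∃ y ∈ iterImage R univ i init, R y x := by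
  simp [iterImage, Function.iterate_succ_apply', relImage]

theorem iterImage_sublist (R : α → α → Bool) (univ : List α) (i : ℕ) (init : List α) :
    (iterImage R univ (i + 1) init).Sublist univ := by
  rw [iterImage, Function.iterate_succ_apply']
  exact List.filter_sublist

theorem TC.iterImage {B : Set (ℕ → ℕ)} [BoundClass B] {γ : Type} [Enc γ] [Enc α]
    {R : γ → α → α → Bool} {univ init : γ → List α} {i : γ → ℕ}
    (hR : TC B (fun x : γ × α × α => R x.1 x.2.1 x.2.2)) (hu : TC B univ) (hi : TC B i)
    (hinit : TC B init) :
    TC B (fun c => TokenSliding.iterImage (R c) (univ c) (i c) (init c)) := by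
  obtain ⟨bu, hbu, hbu'⟩ := out_size hu
  obtain ⟨bi, hbi, hbi'⟩ := out_size hinit
  refine TC.iterate (F := fun c => relImage (R c) (univ c)) hi hinit ?_
    (BoundClass.add_mem _ hbu _ hbi) fun c j _ => ?_
  · refine TC.filter (p := fun (a : γ × List α) x => a.2.any fun y => R a.1 y x) (hu.comp fst)
      (TC.any (p := fun (b : (γ × List α) × α) y => R b.1.1 y b.2) (snd.comp fst) ?_)
    exact hR.comp (pair (fst.comp (fst.comp fst)) (pair snd (snd.comp fst)))
  · cases j with
    | zero => exact (hbi' c).trans (Nat.le_add_left _ _)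
    | succ j =>
      exact (esize_sublist (iterImage_sublist _ _ j _)).trans
        ((hbu' c).trans (Nat.le_add_right _ _))

/-- After as many rounds as there are elements, the iterated image under a reflexive relation
consists of everything that is reachable. -/
theorem mem_iterImage_iff {R : α → α → Bool} {univ init : List α}
    (hrefl : ∀ x ∈ univ, R x x) (hinit : ∀ x ∈ init, x ∈ univ) {n : ℕ} (hn : univ.length ≤ n)
    {x : α} : x ∈ iterImage R univ n init ↔
      ∃ y ∈ init, Relation.ReflTransGen (fun a b => R a b ∧ b ∈ univ) y x := by
  classical
  have hsub : ∀ i, ∀ x ∈ iterImage R univ i init, x ∈ univ := by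
    intro i x hx
    cases i with
    | zero => exact hinit x hx
    | succ i => exact (mem_iterImage_succ.1 hx).1
  have hinc : ∀ i, ∀ x ∈ iterImage R univ i init, x ∈ iterImage R univ (i + 1) init :=
    fun i x hx => mem_iterImage_succ.2 ⟨hsub i x hx, x, hx, hrefl x (hsub i x hx)⟩
  constructor
  · clear hn
    induction n generalizing x with
    | zero => exact fun hx => ⟨x, hx, .refl⟩
    | succ n ih =>
      intro hx
      obtain ⟨hxu, y, hy, hyx⟩ := mem_iterImage_succ.1 hx
      obtain ⟨z, hz, hzy⟩ := ih hy
      exact ⟨z, hz, hzy.tail ⟨hyx, hxu⟩⟩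
  · rintro ⟨y, hy, hyx⟩
    -- each round either adds an element or is the last one to change anything
    have hgrow : ∀ i, i ≤ (iterImage R univ i init).toFinset.card ∨
        ∀ x ∈ iterImage R univ (i + 1) init, x ∈ iterImage R univ i init := by
      intro i
      induction i with
      | zero => exact Or.inl (Nat.zero_le _)
      | succ i ih =>
        by_cases hst : ∀ x ∈ iterImage R univ (i + 1) init, x ∈ iterImage R univ i init
        · refine Or.inr fun x hx => ?_
          obtain ⟨hxu, y, hy, hyx⟩ := mem_iterImage_succ.1 hx
          exact mem_iterImage_succ.2 ⟨hxu, y, hst y hy, hyx⟩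
        · left
          have h1 := ih.resolve_right hst
          push Not at hst
          obtain ⟨z, hz, hz'⟩ := hst
          have : (iterImage R univ i init).toFinset ⊂ (iterImage R univ (i + 1) init).toFinset := by
            rw [Finset.ssubset_iff_of_subset fun x hx => by
              simp only [List.mem_toFinset] at *; exact hinc i x hx]
            exact ⟨z, by simpa using hz, by simpa using hz'⟩
          have := Finset.card_lt_card this
          omega
    have hstable : ∀ x ∈ iterImage R univ (n + 1) init, x ∈ iterImage R univ n init := by
      rcases hgrow n with h | h
      · have h1 : (iterImage R univ n init).toFinset ⊆ univ.toFinset := fun x hx => by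
          simp only [List.mem_toFinset] at *; exact hsub n x hx
        have h2 := List.toFinset_card_le univ
        have h3 := Finset.eq_of_subset_of_card_le h1 (by omega)
        intro x hx
        have h4 : x ∈ univ.toFinset := by simpa using hsub _ x hx
        rw [← h3] at h4
        simpa using h4
      · exact h
    have hstart : ∀ i, y ∈ iterImage R univ i init := by
      intro i
      induction i with
      | zero => exact hy
      | succ i ih => exact hinc i y ih
    induction hyx with
    | refl => exact hstart n
    | tail _ h ih => exact hstable _ (mem_iterImage_succ.2 ⟨h.2, _, ih, h.1⟩)

end IterImage

/-! ### Token slides -/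

section Slides

variable {n : ℕ} {G : SimpleGraph (Fin n)}

/-- `J` can be obtained from `I` by token slides through independent sets. -/
abbrev TSReach (G : SimpleGraph (Fin n)) : Finset (Fin n) → Finset (Fin n) → Prop :=
  Relation.ReflTransGen (TSStep G)

theorem isIndepSet_iff {I : Finset (Fin n)} :
    G.IsIndepSet (I : Set (Fin n)) ↔ ∀ u ∈ I, ∀ v ∈ I, ¬ G.Adj u v := by
  refine ⟨fun h u hu v hv huv => h hu hv huv.ne huv, fun h u hu v hv _ => h u hu v hv⟩

theorem TSStep.symm {I J : Finset (Fin n)} (h : TSStep G I J) : TSStep G J I := by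
  obtain ⟨hI, hJ, u, v, hu, hv, huv, rfl⟩ := h
  refine ⟨hJ, hI, v, u, by simp, ?_, huv.symm, ?_⟩
  · simp [huv.ne]
  · rw [Finset.erase_insert (fun h => hv (Finset.mem_of_mem_erase h)), Finset.insert_erase hu]

theorem TSReach.symm {I J : Finset (Fin n)} (h : TSReach G I J) : TSReach G J I := by
  induction h with
  | refl => exact .refl
  | tail _ h ih => exact Relation.ReflTransGen.head h.symm ih

theorem TSStep.of_insert {W : Finset (Fin n)} {u v : Fin n} (hu : u ∉ W) (hv : v ∉ W)
    (huv : G.Adj u v) (h1 : G.IsIndepSet (insert u W : Finset (Fin n)))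
    (h2 : G.IsIndepSet (insert v W : Finset (Fin n))) : TSStep G (insert u W) (insert v W) :=
  ⟨h1, h2, u, v, by simp, by simp [hv, huv.ne'], huv, by rw [Finset.erase_insert hu]⟩

theorem isIndepSet_insert_iff {W : Finset (Fin n)} {u : Fin n} :
    G.IsIndepSet (insert u W : Finset (Fin n)) ↔
      G.IsIndepSet (W : Set (Fin n)) ∧ ∀ w ∈ W, ¬ G.Adj u w := by
  simp only [isIndepSet_iff, Finset.mem_insert]
  constructor
  · exact fun h => ⟨fun x hx y hy => h x (Or.inr hx) y (Or.inr hy),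
      fun w hw => h u (Or.inl rfl) w (Or.inr hw)⟩
  · rintro ⟨h1, h2⟩ x (rfl | hx) y (rfl | hy)
    · exact G.irrefl
    · exact h2 y hy
    · exact fun h => h2 x hx h.symm
    · exact h1 x hx y hy

end Slides

/-! ### Tokens stored on a geodesic -/

/-- The first `j` even numbers: the packed positions of `j` tokens on a path. -/
def evens (j : ℕ) : Finset ℕ := (Finset.range j).image fun s => 2 * s

/-- A set of positions on a path without consecutive members. -/
def Sparse (T : Finset ℕ) : Prop := ∀ i ∈ T, i + 1 ∉ T

theorem mem_evens {i j : ℕ} : i ∈ evens j ↔ ∃ s < j, i = 2 * s := by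
  simp [evens, eq_comm]

theorem sparse_evens (j : ℕ) : Sparse (evens j) := by
  intro i hi hi'
  rw [mem_evens] at hi hi'
  omega

theorem card_evens (j : ℕ) : (evens j).card = j := by
  rw [evens, Finset.card_image_of_injective _ fun a b h => by simpa using h, Finset.card_range]

theorem eq_evens_of_closed {T : Finset ℕ} (h : ∀ i ∈ T, i = 0 ∨ 2 ≤ i ∧ i - 2 ∈ T) :
    T = evens T.card := by
  have hdown : ∀ i ∈ T, ∃ s, i = 2 * s ∧ ∀ r ≤ s, 2 * r ∈ T := by
    intro i
    induction i using Nat.strong_induction_on with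
    | _ i ih =>
      intro hi
      rcases h i hi with rfl | ⟨h2, h3⟩
      · exact ⟨0, rfl, fun r hr => by simpa [Nat.le_zero.1 hr] using hi⟩
      · obtain ⟨s, hs, hs'⟩ := ih _ (by omega) h3
        refine ⟨s + 1, by omega, fun r hr => ?_⟩
        rcases Nat.lt_or_ge s r with hsr | hsr
        · rwa [show 2 * r = i by omega]
        · exact hs' r hsr
  have hle : ∀ s, 2 * s ∈ T → s < T.card := by
    intro s hs
    obtain ⟨s', hss', hs'⟩ := hdown _ hs
    obtain rfl : s = s' := by omega
    have : evens (s + 1) ⊆ T := fun i hi => by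
      obtain ⟨r, hr, rfl⟩ := mem_evens.1 hi
      exact hs' r (by omega)
    have := Finset.card_le_card this
    rw [card_evens] at this
    omega
  refine Finset.eq_of_subset_of_card_le (fun i hi => ?_) (by rw [card_evens])
  obtain ⟨s, rfl, _⟩ := hdown i hi
  exact mem_evens.2 ⟨s, hle s hi, rfl⟩

/-- Positions for `j` tokens that keep clear of the five positions around `i`. -/
def gapped (i j : ℕ) : Finset ℕ :=
  (Finset.range j).image fun s => if 2 * s + 2 < i then 2 * s else 2 * s + 5

theorem mem_gapped {i j t : ℕ} : t ∈ gapped i j ↔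
    ∃ s < j, t = if 2 * s + 2 < i then 2 * s else 2 * s + 5 := by
  simp [gapped, eq_comm]

theorem gapped_lt {i j t : ℕ} (h : t ∈ gapped i j) : t < 2 * j + 4 := by
  obtain ⟨s, hs, rfl⟩ := mem_gapped.1 h
  split_ifs <;> omega

theorem gapped_far {i j t : ℕ} (h : t ∈ gapped i j) : t + 2 < i ∨ i + 2 < t := by
  obtain ⟨s, hs, rfl⟩ := mem_gapped.1 h
  split_ifs <;> omega

theorem sparse_gapped (i j : ℕ) : Sparse (gapped i j) := by
  intro t ht ht'
  obtain ⟨s, hs, rfl⟩ := mem_gapped.1 ht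
  obtain ⟨s', hs', h⟩ := mem_gapped.1 ht'
  split_ifs at h <;> omega

theorem card_gapped (i j : ℕ) : (gapped i j).card = j := by
  rw [gapped, Finset.card_image_of_injOn, Finset.card_range]
  intro s _ s' _ h
  dsimp only at h
  split_ifs at h <;> omega

/-- `q 0, …, q N` is a path that climbs one level of `D` per step, where adjacent vertices are at
most one level apart; such a path is induced. -/
structure ClimbingPath {n : ℕ} (G : SimpleGraph (Fin n)) (D : Fin n → ℕ) (q : ℕ → Fin n)
    (N : ℕ) : Prop where
  lip : ∀ u v, G.Adj u v → D u ≤ D v + 1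
  level : ∀ i ≤ N, D (q i) = 4 + i
  adj : ∀ i < N, G.Adj (q i) (q (i + 1))
  one_le : 1 ≤ N

namespace ClimbingPath

variable {n N : ℕ} {G : SimpleGraph (Fin n)} {D : Fin n → ℕ} {q : ℕ → Fin n}

theorem inj (hq : ClimbingPath G D q N) {i j : ℕ} (hi : i ≤ N) (hj : j ≤ N) (h : q i = q j) :
    i = j := by
  have h1 := hq.level i hi
  have h2 := hq.level j hj
  rw [h] at h1
  omega

theorem not_adj (hq : ClimbingPath G D q N) {T : Finset ℕ} (hT : Sparse T) {i j : ℕ} (hi : i ≤ N)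
    (hj : j ≤ N) (hiT : i ∈ T) (hjT : j ∈ T) : ¬ G.Adj (q i) (q j) := by
  intro h
  have h1 := hq.lip _ _ h
  have h2 := hq.lip _ _ h.symm
  rw [hq.level i hi, hq.level j hj] at h1 h2
  rcases lt_trichotomy i j with hij | rfl | hij
  · exact hT i hiT (by rwa [show i + 1 = j by omega])
  · exact G.irrefl h
  · exact hT j hjT (by rwa [show j + 1 = i by omega])

theorem exists_adj (hq : ClimbingPath G D q N) {i : ℕ} (hi : i ≤ N) :
    ∃ j ≤ N, G.Adj (q i) (q j) := by
  rcases Nat.eq_zero_or_pos i with rfl | hpos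
  · exact ⟨1, hq.one_le, hq.adj 0 hq.one_le⟩
  · refine ⟨i - 1, by omega, ?_⟩
    have := (hq.adj (i - 1) (by omega)).symm
    rwa [Nat.sub_add_cancel hpos] at this

/-- A vertex without neighbours on the path does not lie on it. -/
theorem ne_of_not_adj (hq : ClimbingPath G D q N) {w : Fin n} (hw : ∀ i ≤ N, ¬ G.Adj w (q i))
    {i : ℕ} (hi : i ≤ N) : q i ≠ w := by
  rintro rfl
  obtain ⟨j, hj, h⟩ := hq.exists_adj hi
  exact hw j hj h

theorem isIndepSet_union (hq : ClimbingPath G D q N) {W : Finset (Fin n)}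
    (hW : G.IsIndepSet (W : Set (Fin n))) {T : Finset ℕ} (hT : Sparse T) (hTN : ∀ i ∈ T, i ≤ N)
    (hWq : ∀ w ∈ W, ∀ i ∈ T, ¬ G.Adj w (q i)) :
    G.IsIndepSet (W ∪ T.image q : Finset (Fin n)) := by
  rw [isIndepSet_iff] at *
  simp only [Finset.mem_union, Finset.mem_image]
  rintro u (hu | ⟨i, hi, rfl⟩) v (hv | ⟨j, hj, rfl⟩)
  · exact hW u hu v hv
  · exact hWq u hu j hj
  · exact fun h => hWq v hv i hi h.symm
  · exact hq.not_adj hT (hTN i hi) (hTN j hj) hi hj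

/-- Tokens on the path can be packed at its lower end while the others rest. -/
theorem reach_pack (hq : ClimbingPath G D q N) {W : Finset (Fin n)}
    (hW : G.IsIndepSet (W : Set (Fin n))) (hWq : ∀ w ∈ W, ∀ i ≤ N, ¬ G.Adj w (q i))
    (T : Finset ℕ) (hT : Sparse T) (hTN : ∀ i ∈ T, i ≤ N) :
    TSReach G (W ∪ T.image q) (W ∪ (evens T.card).image q) := by
  induction hs : ∑ i ∈ T, i using Nat.strong_induction_on generalizing T with
  | _ s ih =>
    by_cases hcl : ∀ i ∈ T, i = 0 ∨ 2 ≤ i ∧ i - 2 ∈ T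
    · rw [← eq_evens_of_closed hcl]
    · push Not at hcl
      obtain ⟨i, hi, hi0, hi2⟩ := hcl
      have hi1 : i - 1 ∉ T := fun h => hT _ h (by rwa [Nat.sub_add_cancel (by omega)])
      have hi1' : i - 1 ∉ T.erase i := fun h => hi1 (Finset.mem_of_mem_erase h)
      have hT' : Sparse (insert (i - 1) (T.erase i)) := by
        intro j hj hj'
        rw [Finset.mem_insert, Finset.mem_erase] at hj hj'
        rcases hj with rfl | ⟨hj1, hj2⟩ <;> rcases hj' with h | ⟨h1, h2⟩
        · omega
        · omega
        · exact hi2 (by omega) (by rwa [show i - 2 = j by omega])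
        · exact hT j hj2 h2
      have hTN' : ∀ j ∈ insert (i - 1) (T.erase i), j ≤ N := by
        intro j hj
        rcases Finset.mem_insert.1 hj with rfl | hj
        · have := hTN i hi; omega
        · exact hTN j (Finset.mem_of_mem_erase hj)
      have hsum : ∑ j ∈ insert (i - 1) (T.erase i), j < s := by
        rw [Finset.sum_insert hi1', ← hs, ← Finset.add_sum_erase T _ hi]
        omega
      have hcard : (insert (i - 1) (T.erase i)).card = T.card := by
        rw [Finset.card_insert_of_notMem hi1', Finset.card_erase_add_one hi]
      have key := ih _ hsum _ hT' hTN' rfl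
      rw [hcard] at key
      refine Relation.ReflTransGen.head ?_ key
      have hnot : ∀ j ≤ N, j ∉ T.erase i → q j ∉ W ∪ (T.erase i).image q := by
        intro j hj hjT h
        rcases Finset.mem_union.1 h with h | h
        · exact hq.ne_of_not_adj (hWq _ h) hj rfl
        · obtain ⟨l, hl, hlj⟩ := Finset.mem_image.1 h
          rw [hq.inj (hTN l (Finset.mem_of_mem_erase hl)) hj hlj] at hl
          exact hjT hl
      have hI1 := hq.isIndepSet_union hW hT hTN fun w hw i hi => hWq w hw i (hTN i hi)
      have hI2 := hq.isIndepSet_union hW hT' hTN' fun w hw i hi => hWq w hw i (hTN' i hi)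
      have e1 : W ∪ T.image q = insert (q i) (W ∪ (T.erase i).image q) := by
        conv_lhs => rw [← Finset.insert_erase hi, Finset.image_insert, Finset.union_insert]
      have e2 : W ∪ (insert (i - 1) (T.erase i)).image q =
          insert (q (i - 1)) (W ∪ (T.erase i).image q) := by
        rw [Finset.image_insert, Finset.union_insert]
      rw [e1] at hI1 ⊢
      rw [e2] at hI2 ⊢
      have hiN := hTN i hi
      refine TSStep.of_insert (hnot i hiN (by simp)) (hnot (i - 1) (by omega) hi1') ?_ hI1 hI2
      have := (hq.adj (i - 1) (by omega)).symm
      rwa [Nat.sub_add_cancel (by omega)] at this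

/-- A token that walks within a region `C` without tokens other than those stored on the path is
absorbed by the path: when it first becomes adjacent to the path, the stored tokens make room.  A path of `2 * j + 4` vertices is long enough for `j` tokens
to keep clear of five consecutive positions. -/
theorem reach_absorb (hq : ClimbingPath G D q N) {C : Fin n → Prop} {O : Finset (Fin n)}
    (hqC : ∀ i ≤ N, C (q i)) (hO : G.IsIndepSet (O : Set (Fin n)))
    (hOC : ∀ o ∈ O, ∀ c, C c → ¬ G.Adj o c) (hOC' : ∀ o ∈ O, ¬ C o) {j : ℕ} (hj : 2 * j + 3 ≤ N)
    {w : Fin n} (hw : Relation.ReflTransGen (fun x y => G.Adj x y ∧ C y) w (q 0))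
    (hwq : ∀ i ≤ N, ¬ G.Adj w (q i)) (hwO : G.IsIndepSet (insert w O : Finset (Fin n)))
    (hwO' : w ∉ O) :
    TSReach G (insert w (O ∪ (evens j).image q)) (O ∪ (evens (j + 1)).image q) := by
  have hev : ∀ i ∈ evens j, i ≤ N := fun i hi => by
    obtain ⟨s, hs, rfl⟩ := mem_evens.1 hi; omega
  have hga : ∀ l, ∀ i ∈ gapped l j, i ≤ N := fun l i hi => by have := gapped_lt hi; omega
  have hOq : ∀ o ∈ O, ∀ i ≤ N, ¬ G.Adj o (q i) := fun o ho i hi => hOC o ho _ (hqC i hi)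
  have hnotin : ∀ {v : Fin n} {T : Finset ℕ}, v ∉ O → (∀ i ∈ T, i ≤ N) → (∀ i ∈ T, q i ≠ v) →
      v ∉ O ∪ T.image q := by
    intro v T h1 h2 h3 h
    rcases Finset.mem_union.1 h with h | h
    · exact h1 h
    · obtain ⟨i, hi, rfl⟩ := Finset.mem_image.1 h
      exact h3 i hi rfl
  have hindep : ∀ {v : Fin n} {T : Finset ℕ}, G.IsIndepSet (insert v O : Finset (Fin n)) →
      Sparse T → (∀ i ∈ T, i ≤ N) → (∀ i ∈ T, ¬ G.Adj v (q i)) →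
      G.IsIndepSet (insert v (O ∪ T.image q) : Finset (Fin n)) := by
    intro v T h1 h2 h3 h4
    rw [← Finset.insert_union]
    refine hq.isIndepSet_union h1 h2 h3 fun u hu i hi => ?_
    rcases Finset.mem_insert.1 hu with rfl | hu
    · exact h4 i hi
    · exact hOq u hu i (h3 i hi)
  induction hw using Relation.ReflTransGen.head_induction_on with
  | refl => exact absurd (hq.adj 0 hq.one_le) (hwq 1 hq.one_le)
  | @head w v hwv _ ih =>
    obtain ⟨hwv, hv⟩ := hwv
    have hvO : v ∉ O := fun h => hOC' v h hv
    have hvOi : G.IsIndepSet (insert v O : Finset (Fin n)) :=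
      isIndepSet_insert_iff.2 ⟨hO, fun o ho h => hOC o ho v hv h.symm⟩
    by_cases hvq : ∀ i ≤ N, ¬ G.Adj v (q i)
    · refine Relation.ReflTransGen.head ?_ (ih hvq hvOi hvO)
      exact TSStep.of_insert (hnotin hwO' hev fun i hi => hq.ne_of_not_adj hwq (hev i hi))
        (hnotin hvO hev fun i hi => hq.ne_of_not_adj hvq (hev i hi)) hwv
        (hindep hwO (sparse_evens j) hev fun i hi => hwq i (hev i hi))
        (hindep hvOi (sparse_evens j) hev fun i hi => hvq i (hev i hi))
    · push Not at hvq
      obtain ⟨i, hi, hvi⟩ := hvq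
      -- the neighbours of `v` on the path are at most two positions away from `i`
      have hfar : ∀ t ∈ gapped i j, ¬ G.Adj v (q t) := by
        intro t ht h
        have h1 := hq.lip _ _ h
        have h2 := hq.lip _ _ h.symm
        have h3 := hq.lip _ _ hvi
        have h4 := hq.lip _ _ hvi.symm
        rw [hq.level t (hga i t ht)] at h1 h2
        rw [hq.level i hi] at h3 h4
        have := gapped_far ht
        omega
      have hne : ∀ t ∈ gapped i j, q t ≠ v := by
        rintro t ht rfl
        have h3 := hq.lip _ _ hvi
        have h4 := hq.lip _ _ hvi.symm
        rw [hq.level i hi, hq.level t (hga i t ht)] at h3 h4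
        have := gapped_far ht
        omega
      have hiT : i ∉ gapped i j := fun h => by have := gapped_far h; omega
      have hsp : Sparse (insert i (gapped i j)) := by
        intro t ht ht'
        rw [Finset.mem_insert] at ht ht'
        rcases ht with rfl | ht <;> rcases ht' with h | h
        · omega
        · have := gapped_far h; omega
        · have := gapped_far ht; omega
        · exact sparse_gapped i j t ht h
      have hspN : ∀ t ∈ insert i (gapped i j), t ≤ N := by
        intro t ht
        rcases Finset.mem_insert.1 ht with rfl | ht
        · exact hi
        · exact hga i t ht
      have r1 : TSReach G (insert w (O ∪ (evens j).image q))
          (insert w (O ∪ (gapped i j).image q)) := by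
        have := hq.reach_pack hwO (fun u hu i hi => by
          rcases Finset.mem_insert.1 hu with rfl | hu
          · exact hwq i hi
          · exact hOq u hu i hi) _ (sparse_gapped i j) (hga i)
        rw [card_gapped, Finset.insert_union, Finset.insert_union] at this
        exact this.symm
      have hI := hindep hvOi (sparse_gapped i j) (hga i) hfar
      have r2 : TSStep G (insert w (O ∪ (gapped i j).image q))
          (insert v (O ∪ (gapped i j).image q)) :=
        TSStep.of_insert
          (hnotin hwO' (hga i) fun t ht => hq.ne_of_not_adj hwq (hga i t ht))
          (hnotin hvO (hga i) hne) hwv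
          (hindep hwO (sparse_gapped i j) (hga i) fun t ht => hwq t (hga i t ht)) hI
      have e : O ∪ (insert i (gapped i j)).image q = insert (q i) (O ∪ (gapped i j).image q) := by
        rw [Finset.image_insert, Finset.union_insert]
      have hI' := hq.isIndepSet_union hO hsp hspN fun o ho t ht => hOq o ho t (hspN t ht)
      have r3 : TSStep G (insert v (O ∪ (gapped i j).image q))
          (O ∪ (insert i (gapped i j)).image q) := by
        rw [e] at hI' ⊢
        refine TSStep.of_insert (hnotin hvO (hga i) hne)
          (hnotin (fun h => hOC' _ h (hqC i hi)) (hga i) fun t ht h => ?_) hvi hI hI'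
        rw [hq.inj (hga i t ht) hi h] at ht
        exact hiT ht
      have r4 := hq.reach_pack hO hOq _ hsp hspN
      rw [Finset.card_insert_of_notMem hiT, card_gapped] at r4
      exact (r1.tail r2).trans (Relation.ReflTransGen.head r3 r4)

end ClimbingPath

/-! ### Contracting deep regions to black holes -/

/-- A galactic graph obtained from (a part of) `G` by contracting regions of `G` to black holes.
`cls a` is the set of vertices that the vertex `a` stands for, `rep a` one of them; planets stand
for single vertices.  `D` is a level function, and every black hole `b` contains the path
`q b 0, q b 1, …`, which starts at level `4` and is long enough to store `k` tokens, whereas the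
planets next to a black hole have level at most `2`. -/
structure Contraction {n m : ℕ} (G : SimpleGraph (Fin n)) (G' : SimpleGraph (Fin m))
    (H : Finset (Fin m)) (k : ℕ) (cls : Fin m → Fin n → Prop) (rep : Fin m → Fin n)
    (D : Fin n → ℕ) (q : Fin m → ℕ → Fin n) : Prop where
  cls_rep : ∀ a, cls a (rep a)
  cls_disj : ∀ a b u, cls a u → cls b u → a = b
  cls_planet : ∀ a, a ∉ H → ∀ u, cls a u → u = rep a
  adj_iff : ∀ a b, G'.Adj a b ↔ a ≠ b ∧ ∃ u v, cls a u ∧ cls b v ∧ G.Adj u v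
  hole_hole : ∀ a ∈ H, ∀ b ∈ H, ¬ G'.Adj a b
  path : ∀ b ∈ H, ClimbingPath G D (q b) (2 * k + 2)
  path_mem : ∀ b ∈ H, ∀ i ≤ 2 * k + 2, cls b (q b i)
  conn : ∀ b ∈ H, ∀ u, cls b u →
    Relation.ReflTransGen (fun x y => G.Adj x y ∧ cls b y) u (q b 0)
  near_hole : ∀ a, a ∉ H → ∀ b ∈ H, G'.Adj a b → D (rep a) ≤ 2

/-- A planet adjacent to a black hole. -/
def IsBoundary {m : ℕ} (G' : SimpleGraph (Fin m)) (H : Finset (Fin m)) (a : Fin m) : Prop :=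
  a ∉ H ∧ ∃ b ∈ H, G'.Adj a b

open Classical in
/-- Where a token on `a` is parked: a token on a planet adjacent to a black hole is moved into
such a black hole, all others stay where they are. -/
noncomputable def park {m : ℕ} (G' : SimpleGraph (Fin m)) (H : Finset (Fin m)) (a : Fin m) :
    Fin m :=
  if h : IsBoundary G' H a then h.2.choose else a

open Classical in
/-- The weight function that arises from `w` by parking all tokens. -/
noncomputable def parked {m : ℕ} (G' : SimpleGraph (Fin m)) (H : Finset (Fin m)) (w : Fin m → ℕ)
    (b : Fin m) : ℕ :=
  ∑ a ∈ Finset.univ.filter fun a => park G' H a = b, w a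

section Park

variable {m : ℕ} {G' : SimpleGraph (Fin m)} {H : Finset (Fin m)}

theorem park_spec {a : Fin m} (h : IsBoundary G' H a) :
    park G' H a ∈ H ∧ G'.Adj a (park G' H a) := by
  rw [park, dif_pos h]
  exact h.2.choose_spec

theorem park_eq {a : Fin m} (h : ¬ IsBoundary G' H a) : park G' H a = a := dif_neg h

theorem parked_boundary {w : Fin m → ℕ} {a : Fin m} (h : IsBoundary G' H a) :
    parked G' H w a = 0 := by
  refine Finset.sum_eq_zero fun c hc => ?_
  rw [Finset.mem_filter] at hc
  by_cases hb : IsBoundary G' H c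
  · exact absurd (hc.2 ▸ (park_spec hb).1) h.1
  · rw [park_eq hb] at hc
    exact absurd (hc.2 ▸ h) hb

theorem parked_planet {w : Fin m → ℕ} {a : Fin m} (h : ¬ IsBoundary G' H a) (ha : a ∉ H) :
    parked G' H w a = w a := by
  rw [parked, Finset.sum_eq_single_of_mem a (by simp [park_eq h])]
  intro c hc hca
  rw [Finset.mem_filter] at hc
  by_cases hb : IsBoundary G' H c
  · exact absurd (hc.2 ▸ (park_spec hb).1) ha
  · rw [park_eq hb] at hc
    exact absurd hc.2 hca

theorem parked_le (w : Fin m → ℕ) (a : Fin m) : parked G' H w a ≤ ∑ c, w c :=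
  Finset.sum_le_sum_of_subset (Finset.filter_subset _ _)

theorem parked_add_single (w : Fin m → ℕ) (a : Fin m) :
    parked G' H (w + Pi.single a 1) = parked G' H w + Pi.single (park G' H a) 1 := by
  funext b
  simp only [parked, Pi.add_apply, Finset.sum_add_distrib]
  congr 1
  by_cases h : park G' H a = b
  · subst h
    rw [Finset.sum_eq_single_of_mem a (by simp) fun c _ hc => Pi.single_eq_of_ne hc _]
    simp
  · rw [Pi.single_eq_of_ne (Ne.symm h)]
    refine Finset.sum_eq_zero fun c hc => ?_
    rw [Finset.mem_filter] at hc
    exact Pi.single_eq_of_ne (by rintro rfl; exact h hc.2) _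

end Park

open Classical in
/-- The token set that represents a weight function: tokens on planets stay there, those in a
black hole are packed on its path. -/
noncomputable def place {n m : ℕ} (H : Finset (Fin m)) (rep : Fin m → Fin n)
    (q : Fin m → ℕ → Fin n) (z : Fin m → ℕ) : Finset (Fin n) :=
  (Finset.univ.filter fun a => a ∉ H ∧ z a ≠ 0).image rep ∪
    H.biUnion fun b => (evens (z b)).image (q b)

theorem mem_place {n m : ℕ} {H : Finset (Fin m)} {rep : Fin m → Fin n}
    {q : Fin m → ℕ → Fin n} {z : Fin m → ℕ} {x : Fin n} :
    x ∈ place H rep q z ↔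
      (∃ a, a ∉ H ∧ z a ≠ 0 ∧ rep a = x) ∨ ∃ b ∈ H, ∃ i ∈ evens (z b), q b i = x := by
  simp only [place, Finset.mem_union, Finset.mem_image, Finset.mem_filter, Finset.mem_univ,
    true_and, Finset.mem_biUnion, and_assoc]

namespace Contraction

variable {n m k : ℕ} {G : SimpleGraph (Fin n)} {G' : SimpleGraph (Fin m)} {H : Finset (Fin m)}
  {cls : Fin m → Fin n → Prop} {rep : Fin m → Fin n} {D : Fin n → ℕ} {q : Fin m → ℕ → Fin n}

theorem not_adj_hole (hc : Contraction G G' H k cls rep D q) {a b : Fin m} (ha : a ∉ H)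
    (hb : b ∈ H) (hn : ¬ IsBoundary G' H a) {u : Fin n} (hu : cls b u) : ¬ G.Adj (rep a) u :=
  fun h => hn ⟨ha, b, hb, (hc.adj_iff a b).2
    ⟨by rintro rfl; exact ha hb, _, _, hc.cls_rep a, hu, h⟩⟩

theorem not_adj_path (hc : Contraction G G' H k cls rep D q) {a b : Fin m} (ha : a ∉ H)
    (hb : b ∈ H) {i : ℕ} (hi : i ≤ 2 * k + 2) : ¬ G.Adj (rep a) (q b i) := by
  intro h
  have h1 := hc.near_hole a ha b hb ((hc.adj_iff a b).2
    ⟨by rintro rfl; exact ha hb, _, _, hc.cls_rep a, hc.path_mem b hb i hi, h⟩)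
  have h2 := (hc.path b hb).lip _ _ h.symm
  rw [(hc.path b hb).level i hi] at h2
  omega

theorem rep_ne_path (hc : Contraction G G' H k cls rep D q) {a b : Fin m} (ha : a ∉ H)
    (hb : b ∈ H) {u : Fin n} (hu : cls b u) : rep a ≠ u := by
  rintro rfl
  have := hc.cls_disj _ _ _ (hc.cls_rep a) hu
  exact ha (this ▸ hb)

theorem evens_le {z i k : ℕ} (hz : z ≤ k) (hi : i ∈ evens z) : i ≤ 2 * k + 2 := by
  obtain ⟨s, hs, rfl⟩ := mem_evens.1 hi; omega

theorem isIndepSet_place (hc : Contraction G G' H k cls rep D q) {z : Fin m → ℕ}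
    (hz' : ∀ a b, a ∉ H → b ∉ H → G'.Adj a b → z a = 0 ∨ z b = 0) (hzk : ∀ b ∈ H, z b ≤ k) :
    G.IsIndepSet (place H rep q z : Set (Fin n)) := by
  rw [isIndepSet_iff]
  intro u hu v hv huv
  rw [mem_place] at hu hv
  rcases hu with ⟨a, ha, hza, rfl⟩ | ⟨b, hb, i, hi, rfl⟩ <;>
  rcases hv with ⟨a', ha', hza', rfl⟩ | ⟨b', hb', i', hi', rfl⟩
  · have hne : a ≠ a' := by rintro rfl; exact G.irrefl huv
    rcases hz' a a' ha ha' ((hc.adj_iff a a').2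
      ⟨hne, _, _, hc.cls_rep a, hc.cls_rep a', huv⟩) with h | h
    · exact hza h
    · exact hza' h
  · exact hc.not_adj_path ha hb' (evens_le (hzk b' hb') hi') huv
  · exact hc.not_adj_path ha' hb (evens_le (hzk b hb) hi) huv.symm
  · by_cases hbb : b = b'
    · subst hbb
      exact (hc.path b hb).not_adj (sparse_evens _) (evens_le (hzk b hb) hi)
        (evens_le (hzk b hb') hi') hi hi' huv
    · exact hc.hole_hole b hb b' hb' ((hc.adj_iff b b').2 ⟨hbb, _, _,
        hc.path_mem b hb i (evens_le (hzk b hb) hi),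
        hc.path_mem b' hb' i' (evens_le (hzk b' hb') hi'), huv⟩)

theorem place_add_planet {z : Fin m → ℕ} {a : Fin m} (ha : a ∉ H) :
    place H rep q (z + Pi.single a 1) = insert (rep a) (place H rep q z) := by
  have hH : ∀ b ∈ H, (z + Pi.single a 1 : Fin m → ℕ) b = z b := fun b hb => by
    rw [Pi.add_apply, Pi.single_eq_of_ne (by rintro rfl; exact ha hb), add_zero]
  ext x
  rw [Finset.mem_insert, mem_place, mem_place]
  have h2 : (∃ b ∈ H, ∃ i ∈ evens ((z + Pi.single a 1 : Fin m → ℕ) b), q b i = x) ↔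
      ∃ b ∈ H, ∃ i ∈ evens (z b), q b i = x :=
    exists_congr fun b => and_congr_right fun hb => by rw [hH b hb]
  rw [h2, ← or_assoc]
  refine or_congr_left ⟨?_, ?_⟩
  · rintro ⟨c, hc, hzc, rfl⟩
    by_cases hca : c = a
    · exact Or.inl (by rw [hca])
    · refine Or.inr ⟨c, hc, ?_, rfl⟩
      rwa [Pi.add_apply, Pi.single_eq_of_ne hca, add_zero] at hzc
  · rintro (rfl | ⟨c, hc, hzc, rfl⟩)
    · exact ⟨a, ha, by simp, rfl⟩
    · exact ⟨c, hc, by rw [Pi.add_apply]; omega, rfl⟩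

/-- A token on a planet next to a black hole can be moved into the black hole. -/
theorem reach_place_hole (hc : Contraction G G' H k cls rep D q) {z : Fin m → ℕ}
    (hz : ∀ a, a ∉ H → z a ≠ 0 → ¬ IsBoundary G' H a) (hzk : ∀ b ∈ H, z b < k)
    {a b : Fin m} (ha : a ∉ H) (hb : b ∈ H) (hab : G'.Adj a b)
    (hI : G.IsIndepSet (insert (rep a) (place H rep q z) : Finset (Fin n)))
    (hI' : rep a ∉ place H rep q z) :
    TSReach G (insert (rep a) (place H rep q z)) (place H rep q (z + Pi.single b 1)) := by
  classical
  -- `z0` describes the tokens outside the black hole `b`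
  set z0 : Fin m → ℕ := fun c => if c = b then 0 else z c with hz0
  have hz0H : ∀ c, c ∉ H → z0 c = z c := fun c hc => if_neg (by rintro rfl; exact hc hb)
  have hz0b : z0 b = 0 := if_pos rfl
  have hz0ne : ∀ c, c ≠ b → z0 c = z c := fun c hc => if_neg hc
  have hmem : ∀ y : Fin m → ℕ, (∀ c, c ≠ b → y c = z c) →
      place H rep q y = place H rep q z0 ∪ (evens (y b)).image (q b) := by
    intro y hy
    ext x
    rw [Finset.mem_union, mem_place, mem_place, Finset.mem_image, or_assoc]
    refine or_congr (exists_congr fun c => and_congr_right fun hc => ?_) ⟨?_, ?_⟩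
    · rw [hz0H c hc, hy c (by rintro rfl; exact hc hb)]
    · rintro ⟨c, hc, i, hi, rfl⟩
      by_cases hcb : c = b
      · subst hcb; exact Or.inr ⟨i, hi, rfl⟩
      · refine Or.inl ⟨c, hc, i, ?_, rfl⟩
        rwa [hz0ne c hcb, ← hy c hcb]
    · rintro (⟨c, hc, i, hi, rfl⟩ | ⟨i, hi, rfl⟩)
      · by_cases hcb : c = b
        · subst hcb
          rw [hz0b] at hi
          simp [evens] at hi
        · refine ⟨c, hc, i, ?_, rfl⟩
          rwa [hz0ne c hcb, ← hy c hcb] at hi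
      · exact ⟨b, hb, i, hi, rfl⟩
  have hz0le : ∀ c, z0 c ≤ z c := fun c => by rw [hz0]; dsimp only; split_ifs <;> omega
  have hsub : place H rep q z0 ⊆ place H rep q z := by
    rw [hmem z fun _ _ => rfl]; exact Finset.subset_union_left
  have hO : G.IsIndepSet (place H rep q z0 : Set (Fin n)) :=
    ((isIndepSet_insert_iff.1 hI).1).mono (by exact_mod_cast hsub)
  obtain ⟨-, u, v, hu, hv, huv⟩ := (hc.adj_iff a b).1 hab
  obtain rfl := hc.cls_planet a ha u hu
  have hz0mem : ∀ o ∈ place H rep q z0, (∃ c, c ∉ H ∧ ¬ IsBoundary G' H c ∧ rep c = o) ∨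
      ∃ c ∈ H, c ≠ b ∧ cls c o := by
    intro o ho
    rcases mem_place.1 ho with ⟨c, hc1, hc2, rfl⟩ | ⟨c, hc1, i, hi, rfl⟩
    · exact Or.inl ⟨c, hc1, hz c hc1 (by rwa [← hz0H c hc1]), rfl⟩
    · refine Or.inr ⟨c, hc1, ?_, hc.path_mem c hc1 i
        (evens_le ((hz0le c).trans (hzk c hc1).le) hi)⟩
      rintro rfl
      rw [hz0b] at hi
      simp [evens] at hi
  have key := (hc.path b hb).reach_absorb (C := cls b) (O := place H rep q z0) (j := z b)
    (w := rep a) (hc.path_mem b hb) hO ?_ ?_ (by have := hzk b hb; omega)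
    (Relation.ReflTransGen.head ⟨huv, hv⟩ (hc.conn b hb v hv))
    (fun i hi => hc.not_adj_path ha hb hi)
    (hI.mono (by exact_mod_cast Finset.insert_subset_insert _ hsub)) fun h => hI' (hsub h)
  · rw [hmem z fun _ _ => rfl, hmem (z + Pi.single b 1) fun c hcb => by
      rw [Pi.add_apply, Pi.single_eq_of_ne hcb, add_zero]]
    simpa using key
  · intro o ho c hcc h
    rcases hz0mem o ho with ⟨d, hd1, hd2, rfl⟩ | ⟨d, hd1, hd2, hd3⟩
    · exact hc.not_adj_hole hd1 hb hd2 hcc h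
    · exact hc.hole_hole d hd1 b hb ((hc.adj_iff d b).2 ⟨hd2, _, _, hd3, hcc, h⟩)
  · intro o ho h
    rcases hz0mem o ho with ⟨d, hd1, hd2, rfl⟩ | ⟨d, hd1, hd2, hd3⟩
    · exact hc.rep_ne_path hd1 hb h rfl
    · exact hd2 (hc.cls_disj _ _ _ hd3 h)

/-- A galactic slide lifts to a sequence of token slides between the sets that represent the two
weight functions after parking. -/
theorem reach_of_galacticStep (hc : Contraction G G' H k cls rep D q) {w w' : Fin m → ℕ}
    (h : GalacticStep G' H k w w') :
    TSReach G (place H rep q (parked G' H w)) (place H rep q (parked G' H w')) := by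
  obtain ⟨hw, hw', u, v, huv, heq⟩ := h
  -- `x` describes the tokens that do not take part in the slide
  obtain ⟨x, rfl, rfl⟩ : ∃ x : Fin m → ℕ, w = x + Pi.single u 1 ∧ w' = x + Pi.single v 1 := by
    have hval : ∀ a, w' a + (Pi.single u 1 : Fin m → ℕ) a = w a + (Pi.single v 1 : Fin m → ℕ) a :=
      fun a => congrFun heq a
    have hu1 : 1 ≤ w u := by
      have := hval u
      rw [Pi.single_eq_same, Pi.single_eq_of_ne huv.ne] at this
      omega
    refine ⟨fun a => w a - (Pi.single u 1 : Fin m → ℕ) a, ?_, ?_⟩ <;> funext a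
    · by_cases hau : a = u
      · subst hau; simp; omega
      · simp [hau]
    · have := hval a
      by_cases hau : a = u
      · subst hau
        rw [Pi.add_apply]
        rw [Pi.single_eq_same] at *
        omega
      · rw [Pi.add_apply]
        rw [Pi.single_eq_of_ne hau] at *
        omega
  have hsum : ∑ a, x a + 1 = k := by
    have := hw.total
    simpa [Finset.sum_add_distrib] using this
  set z := parked G' H x with hzdef
  have hz : ∀ a, a ∉ H → z a ≠ 0 → ¬ IsBoundary G' H a := fun a _ h hb => h (parked_boundary hb)
  have hzk : ∀ b ∈ H, z b < k := fun b _ => by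
    have : z b ≤ _ := parked_le (G' := G') (H := H) x b; omega
  have hzx : ∀ a, a ∉ H → z a ≤ x a := by
    intro a ha
    by_cases hb : IsBoundary G' H a
    · rw [hzdef, parked_boundary hb]; exact Nat.zero_le _
    · rw [hzdef, parked_planet hb ha]
  have hz' : ∀ a b, a ∉ H → b ∉ H → G'.Adj a b → z a = 0 ∨ z b = 0 := by
    intro a b ha hb hab
    have h1 := hw.planet_indep a b ha hb hab
    have h2 := hzx a ha
    have h3 := hzx b hb
    simp only [Pi.add_apply] at h1
    omega
  -- a token on a planet, next to parked tokens
  have hplanet : ∀ a, a ∉ H → IsGalacticIndep G' H k (x + Pi.single a 1) →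
      G.IsIndepSet (insert (rep a) (place H rep q z) : Finset (Fin n)) ∧
        rep a ∉ place H rep q z := by
    intro a ha hg
    have hxa : x a = 0 := by
      have := hg.planet_le_one a ha
      simp only [Pi.add_apply, Pi.single_eq_same] at this
      omega
    refine ⟨isIndepSet_insert_iff.2 ⟨hc.isIndepSet_place hz' fun b hb => (hzk b hb).le,
      fun y hy hay => ?_⟩, fun hy => ?_⟩
    · rcases mem_place.1 hy with ⟨c, hcH, hzc, rfl⟩ | ⟨b, hb, i, hi, rfl⟩
      · have hne : a ≠ c := by rintro rfl; exact G.irrefl hay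
        have h1 := hg.planet_indep a c ha hcH ((hc.adj_iff a c).2
          ⟨hne, _, _, hc.cls_rep a, hc.cls_rep c, hay⟩)
        have h2 := hzx c hcH
        simp only [Pi.add_apply, Pi.single_eq_same] at h1
        omega
      · exact hc.not_adj_path ha hb (evens_le (hzk b hb).le hi) hay
    · rcases mem_place.1 hy with ⟨c, hcH, hzc, hca⟩ | ⟨b, hb, i, hi, hia⟩
      · have h1 := hc.cls_disj c a _ (hc.cls_rep c) (hca ▸ hc.cls_rep a)
        subst h1
        have := hzx c hcH
        omega
      · exact hc.rep_ne_path ha hb (hc.path_mem b hb i (evens_le (hzk b hb).le hi)) hia.symm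
  have hpark : ∀ a, a ∉ H → IsGalacticIndep G' H k (x + Pi.single a 1) →
      TSReach G (insert (rep a) (place H rep q z))
        (place H rep q (z + Pi.single (park G' H a) 1)) := by
    intro a ha hg
    by_cases hb : IsBoundary G' H a
    · exact hc.reach_place_hole hz hzk ha (park_spec hb).1 (park_spec hb).2
        (hplanet a ha hg).1 (hplanet a ha hg).2
    · rw [park_eq hb, place_add_planet ha]
  have hself : ∀ b ∈ H, park G' H b = b := fun b hb => park_eq fun h => h.1 hb
  rw [parked_add_single, parked_add_single, ← hzdef]
  by_cases hu : u ∈ H <;> by_cases hv : v ∈ H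
  · exact absurd huv (hc.hole_hole u hu v hv)
  · refine TSReach.symm ((hpark v hv hw').symm.trans ?_)
    rw [hself u hu]
    exact hc.reach_place_hole hz hzk hv hu huv.symm (hplanet v hv hw').1 (hplanet v hv hw').2
  · refine (hpark u hu hw).symm.trans ?_
    rw [hself v hv]
    exact hc.reach_place_hole hz hzk hu hv huv (hplanet u hu hw).1 (hplanet u hu hw).2
  · refine (hpark u hu hw).symm.trans (Relation.ReflTransGen.head ?_ (hpark v hv hw'))
    obtain ⟨-, y, y', hy, hy', hyy⟩ := (hc.adj_iff u v).1 huv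
    rw [hc.cls_planet u hu y hy, hc.cls_planet v hv y' hy'] at hyy
    exact TSStep.of_insert (hplanet u hu hw).2 (hplanet v hv hw').2 hyy (hplanet u hu hw).1
      (hplanet v hv hw').1

/-- The number of tokens of `I` that `a` stands for. -/
noncomputable def project (cls : Fin m → Fin n → Prop) (I : Finset (Fin n)) (a : Fin m) : ℕ :=
  open Classical in (I.filter (cls a)).card

theorem project_insert (hc : Contraction G G' H k cls rep D q) {W : Finset (Fin n)} {u : Fin n}
    {a : Fin m} (hu : cls a u) (huW : u ∉ W) :
    project cls (insert u W) = project cls W + Pi.single a 1 := by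
  classical
  funext b
  rw [Pi.add_apply, project, project, Finset.filter_insert]
  by_cases h : cls b u
  · obtain rfl := hc.cls_disj _ _ _ h hu
    rw [if_pos h, Finset.card_insert_of_notMem (by simp [huW]), Pi.single_eq_same]
  · rw [if_neg h, Pi.single_eq_of_ne (by rintro rfl; exact h hu), add_zero]

theorem isGalacticIndep_project (hc : Contraction G G' H k cls rep D q) {I : Finset (Fin n)}
    (hI : G.IsIndepSet (I : Set (Fin n))) (hk : I.card = k) (hcov : ∀ u ∈ I, ∃ a, cls a u) :
    IsGalacticIndep G' H k (project cls I) where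
  planet_le_one a ha := by
    classical
    rw [project, Finset.card_le_one]
    intro u hu v hv
    rw [Finset.mem_filter] at hu hv
    rw [hc.cls_planet a ha u hu.2, hc.cls_planet a ha v hv.2]
  planet_indep a b ha hb hab := by
    classical
    by_contra! h
    obtain ⟨⟨u, hu⟩, ⟨v, hv⟩⟩ := And.intro (Finset.card_ne_zero.1 h.1) (Finset.card_ne_zero.1 h.2)
    rw [Finset.mem_filter] at hu hv
    obtain ⟨-, y, y', hy, hy', hyy⟩ := (hc.adj_iff a b).1 hab
    rw [hc.cls_planet a ha y hy, hc.cls_planet b hb y' hy', ← hc.cls_planet a ha u hu.2,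
      ← hc.cls_planet b hb v hv.2] at hyy
    exact isIndepSet_iff.1 hI u hu.1 v hv.1 hyy
  total := by
    rw [← hk]
    clear hI hk
    induction I using Finset.induction_on with
    | empty => simp [project]
    | insert u W hu ih =>
      obtain ⟨a, ha⟩ := hcov u (by simp)
      rw [hc.project_insert ha hu, Finset.card_insert_of_notMem hu]
      simp only [Pi.add_apply, Finset.sum_add_distrib]
      rw [ih fun v hv => hcov v (by simp [hv])]
      simp

theorem galacticReach_of_step (hc : Contraction G G' H k cls rep D q) {I J : Finset (Fin n)}
    (hk : I.card = k) (hcov : ∀ u ∈ I, ∃ a, cls a u) (hcov' : ∀ u ∈ J, ∃ a, cls a u)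
    (h : TSStep G I J) :
    J.card = k ∧ Relation.ReflTransGen (GalacticStep G' H k) (project cls I) (project cls J) := by
  classical
  obtain ⟨hI, hJ, u, v, hu, hv, huv, rfl⟩ := h
  have hv' : v ∉ I.erase u := fun h => hv (Finset.mem_of_mem_erase h)
  have hk' : (insert v (I.erase u)).card = k := by
    rw [Finset.card_insert_of_notMem hv', Finset.card_erase_add_one hu, hk]
  refine ⟨hk', ?_⟩
  obtain ⟨a, ha⟩ := hcov u hu
  obtain ⟨b, hb⟩ := hcov' v (by simp)
  have e1 : project cls I = project cls (I.erase u) + Pi.single a 1 := by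
    rw [← hc.project_insert ha (Finset.notMem_erase u I), Finset.insert_erase hu]
  have e2 := hc.project_insert hb hv'
  by_cases hab : a = b
  · rw [e1, e2, hab]
  · refine Relation.ReflTransGen.single ⟨hc.isGalacticIndep_project hI hk hcov,
      hc.isGalacticIndep_project hJ hk' hcov', a, b,
      (hc.adj_iff a b).2 ⟨hab, u, v, ha, hb, huv⟩, ?_⟩
    rw [e1, e2]
    abel

theorem place_parked_project (hc : Contraction G G' H k cls rep D q) {I : Finset (Fin n)}
    (hI : ∀ u ∈ I, ∃ a, a ∉ H ∧ ¬ IsBoundary G' H a ∧ rep a = u) :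
    place H rep q (parked G' H (project cls I)) = I := by
  classical
  have hpr : ∀ a, project cls I a ≠ 0 → a ∉ H ∧ ¬ IsBoundary G' H a ∧ rep a ∈ I := by
    intro a ha
    obtain ⟨u, hu⟩ := Finset.card_ne_zero.1 ha
    rw [Finset.mem_filter] at hu
    obtain ⟨b, hb1, hb2, rfl⟩ := hI u hu.1
    obtain rfl := hc.cls_disj _ _ _ (hc.cls_rep b) hu.2
    exact ⟨hb1, hb2, hu.1⟩
  have hholes : ∀ b ∈ H, parked G' H (project cls I) b = 0 := by
    intro b hb
    refine Finset.sum_eq_zero fun a ha => ?_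
    by_contra h0
    obtain ⟨h1, h2, -⟩ := hpr a h0
    rw [Finset.mem_filter, park_eq h2] at ha
    exact h1 (ha.2 ▸ hb)
  ext u
  rw [mem_place]
  constructor
  · rintro (⟨a, ha, hza, rfl⟩ | ⟨b, hb, i, hi, rfl⟩)
    · by_cases hbd : IsBoundary G' H a
      · exact absurd (parked_boundary hbd) hza
      · rw [parked_planet hbd ha] at hza
        exact (hpr a hza).2.2
    · rw [hholes b hb] at hi
      simp [evens] at hi
  · intro hu
    obtain ⟨a, ha, hbd, rfl⟩ := hI u hu
    refine Or.inl ⟨a, ha, ?_, rfl⟩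
    rw [parked_planet hbd ha]
    exact Finset.card_ne_zero.2 ⟨_, Finset.mem_filter.2 ⟨hu, hc.cls_rep a⟩⟩

/-- Contracting deep regions to black holes preserves the answer. -/
theorem reach_iff (hc : Contraction G G' H k cls rep D q) {P : Fin n → Prop}
    (hPadj : ∀ u v, P u → G.Adj u v → P v) (hPcov : ∀ u, P u → ∃ a, cls a u)
    {I J : Finset (Fin n)} (hk : I.card = k) (hIP : ∀ u ∈ I, P u)
    (hI : ∀ u ∈ I, ∃ a, a ∉ H ∧ ¬ IsBoundary G' H a ∧ rep a = u)
    (hJ : ∀ u ∈ J, ∃ a, a ∉ H ∧ ¬ IsBoundary G' H a ∧ rep a = u) :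
    TSReach G I J ↔
      Relation.ReflTransGen (GalacticStep G' H k) (project cls I) (project cls J) := by
  constructor
  · intro h
    suffices h' : J.card = k ∧ (∀ u ∈ J, P u) ∧
        Relation.ReflTransGen (GalacticStep G' H k) (project cls I) (project cls J) from h'.2.2
    clear hJ
    induction h with
    | refl => exact ⟨hk, hIP, .refl⟩
    | @tail J' J'' _ hstep ih =>
      obtain ⟨ih1, ih2, ih3⟩ := ih
      have hP : ∀ u ∈ J'', P u := by
        have hstep := hstep
        obtain ⟨-, -, u, v, hu, -, huv, rfl⟩ := hstep
        intro y hy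
        rcases Finset.mem_insert.1 hy with rfl | hy
        · exact hPadj u _ (ih2 u hu) huv
        · exact ih2 y (Finset.mem_of_mem_erase hy)
      obtain ⟨h1, h2⟩ := hc.galacticReach_of_step ih1 (fun u hu => hPcov u (ih2 u hu))
        (fun u hu => hPcov u (hP u hu)) hstep
      exact ⟨h1, hP, ih3.trans h2⟩
  · intro h
    rw [← hc.place_parked_project hI, ← hc.place_parked_project hJ]
    generalize project cls J = w at h
    induction h with
    | refl => exact .refl
    | tail _ hstep ih => exact ih.trans (hc.reach_of_galacticStep hstep)

end Contraction

/-! ### Balls, levels and deep regions -/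

section Balls

variable {n : ℕ} (G : SimpleGraph (Fin n)) (S : Finset (Fin n))

open Classical in
/-- The vertices at distance at most `i` from `S`. -/
noncomputable def ball : ℕ → Finset (Fin n)
  | 0 => S
  | i + 1 => Finset.univ.filter fun v => ∃ u ∈ ball i, u = v ∨ G.Adj u v

/-- `u` and `v` are joined by a walk that avoids the ball of radius `2`. -/
def OuterConn : Fin n → Fin n → Prop :=
  Relation.ReflTransGen fun u v => G.Adj u v ∧ u ∉ ball G S 2 ∧ v ∉ ball G S 2

/-- The component of `v` outside the ball of radius `2` contains a vertex at distance exactly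
`L + 1` from `S`. -/
def Deep (L : ℕ) (v : Fin n) : Prop :=
  ∃ w, w ∈ ball G S (L + 1) ∧ w ∉ ball G S L ∧ OuterConn G S v w

/-- `u` and `v` are contracted to the same vertex: they are equal or lie in the same deep
component. -/
def Merged (L : ℕ) (u v : Fin n) : Prop := u = v ∨ Deep G S L u ∧ OuterConn G S u v

/-- `v` is the least representative of its class within the ball of radius `L + 1`. -/
def Kept (L : ℕ) (v : Fin n) : Prop :=
  v ∈ ball G S (L + 1) ∧ ∀ u < v, u ∈ ball G S (L + 1) → ¬ Merged G S L u v

/-- The distance of `v` from `S`, cut off at `M`. -/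
noncomputable def level (M : ℕ) (v : Fin n) : ℕ := sInf {i | i = M ∨ v ∈ ball G S i}

variable {G S}

theorem mem_ball_succ {i : ℕ} {v : Fin n} :
    v ∈ ball G S (i + 1) ↔ ∃ u ∈ ball G S i, u = v ∨ G.Adj u v := by
  simp [ball]

theorem ball_mono {i j : ℕ} (h : i ≤ j) : ball G S i ⊆ ball G S j := by
  induction h with
  | refl => exact Finset.Subset.refl _
  | step _ ih => exact fun v hv => mem_ball_succ.2 ⟨v, ih hv, Or.inl rfl⟩

theorem mem_ball_of_adj {i : ℕ} {u v : Fin n} (hu : u ∈ ball G S i) (h : G.Adj u v) :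
    v ∈ ball G S (i + 1) :=
  mem_ball_succ.2 ⟨u, hu, Or.inr h⟩

theorem level_le_of_mem {M i : ℕ} {v : Fin n} (h : v ∈ ball G S i) : level G S M v ≤ i :=
  Nat.sInf_le (Or.inr h)

theorem level_le_succ (M : ℕ) {u v : Fin n} (h : G.Adj u v) :
    level G S M u ≤ level G S M v + 1 := by
  have hv : level G S M v ∈ {i | i = M ∨ v ∈ ball G S i} := Nat.sInf_mem ⟨M, Or.inl rfl⟩
  rcases hv with hv | hv
  · have : level G S M u ≤ M := Nat.sInf_le (Or.inl rfl)
    omega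
  · exact level_le_of_mem (mem_ball_of_adj hv h.symm)

theorem level_eq {M i : ℕ} {v : Fin n} (hi : i ≤ M) (h : v ∈ ball G S i)
    (h' : ∀ l < i, v ∉ ball G S l) : level G S M v = i := by
  have hv : level G S M v ∈ {i | i = M ∨ v ∈ ball G S i} := Nat.sInf_mem ⟨M, Or.inl rfl⟩
  have h1 : level G S M v ≤ i := level_le_of_mem h
  by_contra hne
  have h2 : level G S M v < i := by omega
  rcases hv with hv | hv
  · omega
  · exact h' _ h2 hv

theorem OuterConn.symm {u v : Fin n} (h : OuterConn G S u v) : OuterConn G S v u := by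
  induction h with
  | refl => exact .refl
  | tail _ h ih => exact Relation.ReflTransGen.head ⟨h.1.symm, h.2.2, h.2.1⟩ ih

theorem OuterConn.notMem {u v : Fin n} (h : OuterConn G S u v) (hv : v ∉ ball G S 2) :
    u ∉ ball G S 2 := by
  induction h using Relation.ReflTransGen.head_induction_on with
  | refl => exact hv
  | head h _ _ => exact h.2.1

theorem Deep.notMem {L : ℕ} (hL : 2 ≤ L) {v : Fin n} (h : Deep G S L v) : v ∉ ball G S 2 := by
  obtain ⟨w, -, hw, hvw⟩ := h
  exact OuterConn.notMem hvw fun h => hw (ball_mono hL h)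

theorem Deep.of_conn {L : ℕ} {u v : Fin n} (h : Deep G S L v) (huv : OuterConn G S u v) :
    Deep G S L u := by
  obtain ⟨w, h1, h2, h3⟩ := h
  exact ⟨w, h1, h2, huv.trans h3⟩

theorem Merged.symm {L : ℕ} {u v : Fin n} (h : Merged G S L u v) : Merged G S L v u := by
  rcases h with rfl | ⟨h1, h2⟩
  · exact Or.inl rfl
  · exact Or.inr ⟨h1.of_conn h2.symm, h2.symm⟩

theorem Merged.trans {L : ℕ} {u v w : Fin n} (h : Merged G S L u v) (h' : Merged G S L v w) :
    Merged G S L u w := by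
  rcases h with rfl | ⟨h1, h2⟩
  · exact h'
  · rcases h' with rfl | ⟨-, h4⟩
    · exact Or.inr ⟨h1, h2⟩
    · exact Or.inr ⟨h1, h2.trans h4⟩

theorem exists_kept {L : ℕ} {u w : Fin n} (hw : w ∈ ball G S (L + 1)) (h : Merged G S L w u) :
    ∃ v, Kept G S L v ∧ Merged G S L v u := by
  classical
  obtain ⟨v, hv, hmin⟩ := (Finset.univ.filter fun v => v ∈ ball G S (L + 1) ∧
    Merged G S L v u).exists_minimal ⟨w, by simp [hw, h]⟩
  simp only [Finset.mem_filter, Finset.mem_univ, true_and] at hv hmin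
  refine ⟨v, ⟨hv.1, fun x hx hxM hxv => ?_⟩, hv.2⟩
  exact absurd (hmin ⟨hxM, hxv.trans hv.2⟩ hx.le) (not_le.2 hx)

/-- Everything at finite distance from `S` is represented. -/
theorem exists_kept_of_mem_ball {L : ℕ} (hL : 2 ≤ L) {i : ℕ} {u : Fin n} (hu : u ∈ ball G S i) :
    ∃ v, Kept G S L v ∧ Merged G S L v u := by
  by_cases huM : u ∈ ball G S (L + 1)
  · exact exists_kept huM (Or.inl rfl)
  · have hdeep : ∀ i, ∀ u ∈ ball G S i, u ∉ ball G S (L + 1) → Deep G S L u := by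
      intro i
      induction i with
      | zero => exact fun u hu hu' => absurd (ball_mono (Nat.zero_le _) hu) hu'
      | succ i ih =>
        intro u hu hu'
        obtain ⟨v, hv, rfl | hvu⟩ := mem_ball_succ.1 hu
        · exact ih _ hv hu'
        · have hvL : v ∉ ball G S L := fun h => hu' (mem_ball_of_adj h hvu)
          have huv : OuterConn G S u v := Relation.ReflTransGen.single
            ⟨hvu.symm, fun h => hu' (ball_mono (by omega) h), fun h => hvL (ball_mono hL h)⟩
          by_cases hvM : v ∈ ball G S (L + 1)
          · exact ⟨v, hvM, hvL, huv⟩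
          · exact (ih v hv hvM).of_conn huv
    obtain ⟨w, h1, h2, h3⟩ := hdeep i u hu huM
    exact exists_kept h1 (Or.inr ⟨⟨w, h1, h2, .refl⟩, h3.symm⟩)

/-- A shortest path from `S` to a vertex at distance `i`. -/
theorem exists_geodesic {i : ℕ} {w : Fin n} (hw : w ∈ ball G S i) (hw' : ∀ l < i, w ∉ ball G S l) :
    ∃ p : ℕ → Fin n, (∀ j ≤ i, p j ∈ ball G S j ∧ ∀ l < j, p j ∉ ball G S l) ∧
      (∀ j < i, G.Adj (p j) (p (j + 1))) ∧ p i = w := by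
  induction i generalizing w with
  | zero => exact ⟨fun _ => w, fun j hj => by
      obtain rfl := Nat.le_zero.1 hj; exact ⟨hw, hw'⟩,
      fun j hj => absurd hj (Nat.not_lt_zero j), rfl⟩
  | succ i ih =>
    obtain ⟨u, hu, rfl | huw⟩ := mem_ball_succ.1 hw
    · exact absurd hu (hw' i (Nat.lt_succ_self i))
    · obtain ⟨p, hp1, hp2, rfl⟩ := ih hu fun l hl h =>
        hw' (l + 1) (by omega) (mem_ball_of_adj h huw)
      refine ⟨fun j => if j ≤ i then p j else w, fun j hj => ?_, fun j hj => ?_, by simp⟩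
      · by_cases hji : j ≤ i
        · simpa only [if_pos hji] using hp1 j hji
        · obtain rfl : j = i + 1 := by omega
          simpa only [if_neg hji] using ⟨hw, hw'⟩
      · by_cases hji : j + 1 ≤ i
        · simpa only [if_pos hji, if_pos (Nat.le_of_succ_le hji)] using hp2 j hji
        · obtain rfl : j = i := by omega
          simpa using huw

/-- A deep region contains a path that climbs from level `4` to level `N + 4`. -/
theorem Deep.exists_path {N : ℕ} (hN : 1 ≤ N) {v : Fin n} (h : Deep G S (N + 3) v) :
    ∃ q : ℕ → Fin n, ClimbingPath G (level G S (N + 4)) q N ∧ ∀ i ≤ N, OuterConn G S v (q i) := by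
  obtain ⟨w, hw, hw', hvw⟩ := h
  obtain ⟨p, hp1, hp2, rfl⟩ := exists_geodesic hw fun l hl h => hw' (ball_mono (by omega) h)
  have hout : ∀ j, j ≤ N + 1 → OuterConn G S (p (N + 4 - j)) (p (N + 4)) := by
    intro j
    induction j with
    | zero => exact fun _ => .refl
    | succ j ih =>
      intro hj
      refine Relation.ReflTransGen.head ⟨?_, (hp1 (N + 4 - (j + 1)) (by omega)).2 2 (by omega),
        (hp1 (N + 4 - j) (by omega)).2 2 (by omega)⟩ (ih (by omega))
      have := hp2 (N + 4 - (j + 1)) (by omega)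
      rwa [show N + 4 - (j + 1) + 1 = N + 4 - j by omega] at this
  refine ⟨fun i => p (i + 4), ⟨fun u v huv => level_le_succ _ huv, fun i hi => ?_, fun i hi => ?_,
    hN⟩, fun i hi => ?_⟩
  · rw [level_eq (i := i + 4) (by omega) (hp1 _ (by omega)).1 (hp1 _ (by omega)).2]
    omega
  · have := hp2 (i + 4) (by omega)
    rwa [show i + 4 + 1 = i + 1 + 4 by omega] at this
  · have := hout (N - i) (by omega)
    rw [show N + 4 - (N - i) = i + 4 by omega] at this
    exact hvw.trans this.symm

theorem degree_le_maxDeg (u : Fin n) [Fintype (G.neighborSet u)] : G.degree u ≤ maxDeg G := by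
  classical
  unfold maxDeg
  convert G.degree_le_maxDegree u

theorem card_ball_le (i : ℕ) : (ball G S i).card ≤ S.card * (maxDeg G + 1) ^ i := by
  classical
  induction i with
  | zero => simp [ball]
  | succ i ih =>
    have hsub : ball G S (i + 1) ⊆ (ball G S i).biUnion fun u => insert u (G.neighborFinset u) := by
      intro v hv
      obtain ⟨u, hu, h⟩ := mem_ball_succ.1 hv
      refine Finset.mem_biUnion.2 ⟨u, hu, ?_⟩
      rcases h with rfl | h
      · simp
      · simp [h]
    refine (Finset.card_le_card hsub).trans ((Finset.card_biUnion_le_card_mul _ _ (maxDeg G + 1)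
      fun u _ => ?_).trans ?_)
    · refine (Finset.card_insert_le _ _).trans (Nat.succ_le_succ ?_)
      rw [SimpleGraph.card_neighborFinset_eq_degree]
      exact degree_le_maxDeg u
    · rw [pow_succ, ← mul_assoc]
      exact Nat.mul_le_mul_right _ ih

/-- In a graph of maximum degree `1` the balls do not grow beyond radius `1`. -/
theorem ball_subset_one (h : maxDeg G ≤ 1) (i : ℕ) : ball G S i ⊆ ball G S 1 := by
  classical
  have huniq : ∀ u v w, G.Adj u v → G.Adj u w → v = w := by
    intro u v w hv hw
    have h1 : G.degree u ≤ 1 := (degree_le_maxDeg u).trans h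
    rw [← SimpleGraph.card_neighborFinset_eq_degree, Finset.card_le_one] at h1
    exact h1 v (by simpa using hv) w (by simpa using hw)
  induction i with
  | zero => exact ball_mono (Nat.zero_le _)
  | succ i ih =>
    intro v hv
    obtain ⟨u, hu, rfl | huv⟩ := mem_ball_succ.1 hv
    · exact ih hu
    · obtain ⟨s, hs, rfl | hsu⟩ := mem_ball_succ.1 (ih hu)
      · exact mem_ball_of_adj hs huv
      · rw [huniq u v s huv hsu.symm]
        exact ball_mono (Nat.zero_le _) hs

end Balls

/-! ### The kernel -/

section Kernel

variable {n : ℕ} (G : SimpleGraph (Fin n)) (S : Finset (Fin n)) (k : ℕ)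

open Classical in
/-- The representatives of the contracted graph, in increasing order.  Deep components reach
distance `2 * k + 6` from `S`, so that they contain paths on which `k` tokens can be stored. -/
noncomputable def kernelReps : List (Fin n) :=
  (List.finRange n).filter fun v => Kept G S (2 * k + 5) v

/-- The vertex that represents the class `a`. -/
noncomputable def kernelRep (a : Fin (kernelReps G S k).length) : Fin n := (kernelReps G S k)[a]

/-- Membership of a vertex in the class `a`. -/
def KernelCls (a : Fin (kernelReps G S k).length) (u : Fin n) : Prop :=
  Merged G S (2 * k + 5) (kernelRep G S k a) u

/-- The contracted graph. -/
def kernelGraph : SimpleGraph (Fin (kernelReps G S k).length) where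
  Adj a b := a ≠ b ∧ ∃ u v, KernelCls G S k a u ∧ KernelCls G S k b v ∧ G.Adj u v
  symm := ⟨fun _ _ ⟨h, u, v, hu, hv, huv⟩ => ⟨h.symm, v, u, hv, hu, huv.symm⟩⟩
  loopless := ⟨fun _ h => h.1 rfl⟩

open Classical in
/-- The contracted regions. -/
noncomputable def kernelHoles : Finset (Fin (kernelReps G S k).length) :=
  Finset.univ.filter fun a => Deep G S (2 * k + 5) (kernelRep G S k a)

variable {G S k}

theorem mem_kernelReps {v : Fin n} : v ∈ kernelReps G S k ↔ Kept G S (2 * k + 5) v := by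
  simp [kernelReps]

theorem mem_kernelHoles {a : Fin (kernelReps G S k).length} :
    a ∈ kernelHoles G S k ↔ Deep G S (2 * k + 5) (kernelRep G S k a) := by
  simp [kernelHoles]

theorem nodup_kernelReps : (kernelReps G S k).Nodup := (List.nodup_finRange n).filter _

theorem kernelRep_injective : Function.Injective (kernelRep G S k) := fun _ _ h =>
  Fin.ext ((nodup_kernelReps.getElem_inj_iff).1 h)

theorem kept_kernelRep (a : Fin (kernelReps G S k).length) :
    Kept G S (2 * k + 5) (kernelRep G S k a) :=
  mem_kernelReps.1 (List.getElem_mem _)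

theorem exists_kernelRep {v : Fin n} (h : Kept G S (2 * k + 5) v) : ∃ a, kernelRep G S k a = v := by
  obtain ⟨i, hi, h⟩ := List.mem_iff_getElem.1 (mem_kernelReps.2 h)
  exact ⟨⟨i, hi⟩, h⟩

theorem length_kernelReps_le : (kernelReps G S k).length ≤ (ball G S (2 * k + 6)).card := by
  classical
  rw [← List.toFinset_card_of_nodup nodup_kernelReps]
  exact Finset.card_le_card fun v hv => (mem_kernelReps.1 (List.mem_toFinset.1 hv)).1

theorem kernelCls_disj {a b : Fin (kernelReps G S k).length} {u : Fin n}
    (ha : KernelCls G S k a u) (hb : KernelCls G S k b u) : a = b := by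
  have h := Merged.trans ha (Merged.symm hb)
  rcases lt_trichotomy (kernelRep G S k a) (kernelRep G S k b) with hlt | heq | hlt
  · exact absurd h ((kept_kernelRep b).2 _ hlt (kept_kernelRep a).1)
  · exact kernelRep_injective heq
  · exact absurd h.symm ((kept_kernelRep a).2 _ hlt (kept_kernelRep b).1)

theorem kernelCls_deep {a : Fin (kernelReps G S k).length} {u : Fin n} (ha : a ∈ kernelHoles G S k)
    (hu : KernelCls G S k a u) : u ∉ ball G S 2 ∧ OuterConn G S (kernelRep G S k a) u := by
  have hd := mem_kernelHoles.1 ha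
  have h : OuterConn G S (kernelRep G S k a) u := by
    rcases hu with h | h
    · rw [← h]; exact .refl
    · exact h.2
  exact ⟨(hd.of_conn h.symm).notMem (by omega), h⟩

theorem exists_contraction : ∃ q, Contraction G (kernelGraph G S k) (kernelHoles G S k) k
    (KernelCls G S k) (kernelRep G S k) (level G S (2 * k + 6)) q := by
  have hq : ∀ b : Fin (kernelReps G S k).length, ∃ q : ℕ → Fin n, b ∈ kernelHoles G S k →
      ClimbingPath G (level G S (2 * k + 6)) q (2 * k + 2) ∧
        ∀ i ≤ 2 * k + 2, OuterConn G S (kernelRep G S k b) (q i) := by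
    intro b
    by_cases hb : b ∈ kernelHoles G S k
    · obtain ⟨q, hq⟩ := Deep.exists_path (N := 2 * k + 2) (by omega) (mem_kernelHoles.1 hb)
      exact ⟨q, fun _ => hq⟩
    · exact ⟨fun _ => kernelRep G S k b, fun h => absurd h hb⟩
  choose q hq using hq
  refine ⟨q, fun a => Or.inl rfl, fun a b u => kernelCls_disj, fun a ha u hu => ?_,
    fun a b => Iff.rfl, fun a ha b hb hab => ?_, fun b hb => (hq b hb).1,
    fun b hb i hi => Or.inr ⟨mem_kernelHoles.1 hb, (hq b hb).2 i hi⟩, fun b hb u hu => ?_,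
    fun a ha b hb hab => ?_⟩
  · rcases hu with h | h
    · exact h.symm
    · exact absurd (mem_kernelHoles.2 h.1) ha
  · obtain ⟨hne, u, v, hu, hv, huv⟩ := hab
    have h1 := kernelCls_deep ha hu
    have h2 := kernelCls_deep hb hv
    exact hne (kernelCls_disj (u := v) (Or.inr ⟨mem_kernelHoles.1 ha,
      h1.2.tail ⟨huv, h1.1, h2.1⟩⟩) hv)
  · have h1 := (kernelCls_deep hb hu).2
    have h2 : OuterConn G S u (q b 0) := h1.symm.trans ((hq b hb).2 0 (by omega))
    generalize q b 0 = y at h2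
    induction h2 with
    | refl => exact .refl
    | tail hy hyz ih =>
      exact ih.tail ⟨hyz.1, Or.inr ⟨mem_kernelHoles.1 hb, (h1.trans hy).tail hyz⟩⟩
  · obtain ⟨hne, u, v, hu, hv, huv⟩ := hab
    rcases hu with rfl | hu
    · refine level_le_of_mem ?_
      by_contra hout
      have h2 := kernelCls_deep hb hv
      exact hne (kernelCls_disj (u := kernelRep G S k a) (Or.inl rfl)
        (Or.inr ⟨mem_kernelHoles.1 hb, h2.2.tail ⟨huv.symm, h2.1, hout⟩⟩))
    · exact absurd (mem_kernelHoles.2 hu.1) ha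

theorem exists_kernelCls {i : ℕ} {u : Fin n} (hu : u ∈ ball G S i) : ∃ a, KernelCls G S k a u := by
  obtain ⟨v, hv, hvu⟩ := exists_kept_of_mem_ball (L := 2 * k + 5) (by omega) hu
  obtain ⟨a, rfl⟩ := exists_kernelRep hv
  exact ⟨a, hvu⟩

/-- The vertices of `S` are planets, and black holes are not adjacent to them. -/
theorem exists_kernelRep_of_mem {u : Fin n} (hu : u ∈ S) : ∃ a, a ∉ kernelHoles G S k ∧
    ¬ IsBoundary (kernelGraph G S k) (kernelHoles G S k) a ∧ kernelRep G S k a = u := by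
  have hu0 : u ∈ ball G S 0 := hu
  have hnd : ¬ Deep G S (2 * k + 5) u := fun h =>
    h.notMem (by omega) (ball_mono (Nat.zero_le _) hu0)
  obtain ⟨a, rfl⟩ := exists_kernelRep (k := k) (v := u) ⟨ball_mono (Nat.zero_le _) hu0,
    fun v hv _ h => by
      rcases h with rfl | h
      · exact lt_irrefl _ hv
      · exact hnd (h.1.of_conn h.2.symm)⟩
  have ha : a ∉ kernelHoles G S k := fun h => hnd (mem_kernelHoles.1 h)
  refine ⟨a, ha, ?_, rfl⟩
  rintro ⟨-, b, hb, -, x, y, hx, hy, hxy⟩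
  rcases hx with rfl | hx
  · exact (kernelCls_deep hb hy).1 (ball_mono (by omega) (mem_ball_of_adj hu0 hxy))
  · exact hnd hx.1

theorem project_kernelCls {I : Finset (Fin n)} (hI : I ⊆ S)
    (a : Fin (kernelReps G S k).length) :
    Contraction.project (KernelCls G S k) I a = if kernelRep G S k a ∈ I then 1 else 0 := by
  classical
  have h1 : ∀ u ∈ I, KernelCls G S k a u → u = kernelRep G S k a := by
    intro u hu hau
    obtain ⟨b, -, -, rfl⟩ := exists_kernelRep_of_mem (G := G) (k := k) (hI hu)
    rw [kernelCls_disj hau (Or.inl rfl)]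
  split_ifs with h
  · rw [Contraction.project, Finset.card_eq_one]
    refine ⟨kernelRep G S k a, ?_⟩
    ext u
    simp only [Finset.mem_filter, Finset.mem_singleton]
    exact ⟨fun hu => h1 u hu.1 hu.2, by rintro rfl; exact ⟨h, Or.inl rfl⟩⟩
  · rw [Contraction.project, Finset.card_eq_zero, Finset.filter_eq_empty_iff]
    exact fun u hu hau => h (h1 u hu hau ▸ hu)

theorem kernelGraph_connected (hG : G.Connected) (hS : S.Nonempty) :
    (kernelGraph G S k).Connected := by
  obtain ⟨s, hs⟩ := hS
  have hcov : ∀ u, ∃ i, u ∈ ball G S i := by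
    intro u
    have h := (SimpleGraph.reachable_iff_reflTransGen _ _).1 (hG.preconnected s u)
    induction h with
    | refl => exact ⟨0, hs⟩
    | tail _ h ih =>
      obtain ⟨i, hi⟩ := ih
      exact ⟨i + 1, mem_ball_of_adj hi h⟩
  have hreach : ∀ a u, G.Reachable (kernelRep G S k a) u → ∀ b, KernelCls G S k b u →
      (kernelGraph G S k).Reachable a b := by
    intro a u h
    rw [SimpleGraph.reachable_iff_reflTransGen] at h
    induction h with
    | refl =>
      intro b hb
      rw [kernelCls_disj (a := a) (Or.inl rfl) hb]
    | @tail v w _ h ih =>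
      intro b hb
      obtain ⟨c, hc⟩ := exists_kernelCls (k := k) (hcov v).choose_spec
      refine (ih c hc).trans ?_
      by_cases hcb : c = b
      · rw [hcb]
      · exact SimpleGraph.Adj.reachable ⟨hcb, v, w, hc, hb, h⟩
  obtain ⟨a, -⟩ := exists_kernelCls (k := k) (hcov s).choose_spec
  exact { preconnected := fun a b => hreach a _ (hG.preconnected _ _) b (Or.inl rfl)
          nonempty := ⟨a⟩ }

end Kernel

/-- The galactic instance to which an instance of Token Sliding is reduced. -/
noncomputable def kernel (x : TSInstance) : GalacticInstance where
  n := (kernelReps x.G (x.source ∪ x.target) x.k).length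
  G := kernelGraph x.G (x.source ∪ x.target) x.k
  blackHoles := kernelHoles x.G (x.source ∪ x.target) x.k
  k := x.k
  source := Contraction.project (KernelCls x.G (x.source ∪ x.target) x.k) x.source
  target := Contraction.project (KernelCls x.G (x.source ∪ x.target) x.k) x.target
  source_indep := by
    obtain ⟨q, hq⟩ := exists_contraction (G := x.G) (S := x.source ∪ x.target) (k := x.k)
    exact hq.isGalacticIndep_project x.source_indep x.source_card fun u hu =>
      exists_kernelCls (i := 0) (Finset.mem_union_left _ hu)
  target_indep := by
    obtain ⟨q, hq⟩ := exists_contraction (G := x.G) (S := x.source ∪ x.target) (k := x.k)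
    exact hq.isGalacticIndep_project x.target_indep x.target_card fun u hu =>
      exists_kernelCls (i := 0) (Finset.mem_union_right _ hu)

theorem kernel_equivalent (x : TSInstance) :
    tokenSliding.IsYes x ↔ galacticTokenSliding.IsYes (kernel x) := by
  obtain ⟨q, hq⟩ := exists_contraction (G := x.G) (S := x.source ∪ x.target) (k := x.k)
  refine hq.reach_iff (P := fun u => ∃ i, u ∈ ball x.G (x.source ∪ x.target) i)
    (fun u v ⟨i, hi⟩ h => ⟨i + 1, mem_ball_of_adj hi h⟩) (fun u ⟨i, hi⟩ => exists_kernelCls hi)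
    x.source_card (fun u hu => ⟨0, Finset.mem_union_left _ hu⟩)
    (fun u hu => exists_kernelRep_of_mem (Finset.mem_union_left _ hu))
    (fun u hu => exists_kernelRep_of_mem (Finset.mem_union_right _ hu))

theorem kernel_n_le (x : TSInstance) :
    (kernel x).n ≤ 2 * x.k * (maxDeg x.G + 1) ^ (2 * x.k + 6) := by
  refine length_kernelReps_le.trans ((card_ball_le _).trans (Nat.mul_le_mul_right _ ?_))
  have := Finset.card_union_le x.source x.target
  rw [x.source_card, x.target_card] at this
  omega

theorem kernel_n_le' (x : TSInstance) (hD : 1 ≤ maxDeg x.G) :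
    (kernel x).n ≤ x.k * maxDeg x.G ^ (17 * x.k ^ 2) +
      (2 * x.k + 2 * x.k * maxDeg x.G) * maxDeg x.G := by
  rcases Nat.eq_zero_or_pos x.k with hk | hk
  · have := kernel_n_le x
    rw [hk] at this
    simp at this
    omega
  rcases Nat.lt_or_ge 1 (maxDeg x.G) with hD2 | hD1
  · refine (kernel_n_le x).trans ((?_ : _ ≤ _).trans (Nat.le_add_right _ _))
    set d := maxDeg x.G
    have h1 : d + 1 ≤ d ^ 2 := by nlinarith
    calc 2 * x.k * (d + 1) ^ (2 * x.k + 6) ≤ d * x.k * (d ^ 2) ^ (2 * x.k + 6) := by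
          gcongr
          exact hD2
      _ = x.k * d ^ (4 * x.k + 13) := by rw [← pow_mul]; ring
      _ ≤ x.k * d ^ (17 * x.k ^ 2) := by
          gcongr
          nlinarith
  · -- a matching: every ball around the `2 * k` vertices lies in the ball of radius `1`
    have h1 : maxDeg x.G = 1 := by omega
    have h2 : (kernel x).n ≤ _ :=
      length_kernelReps_le.trans ((Finset.card_le_card (ball_subset_one hD1 _)).trans
        (card_ball_le 1))
    have h3 := Finset.card_union_le x.source x.target
    rw [x.source_card, x.target_card] at h3
    rw [h1] at h2 ⊢
    simp only [one_pow] at *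
    omega

/-! ### The kernel is computable in polynomial time -/

theorem TC.add {B : Set (ℕ → ℕ)} [BoundClass B] {α : Type} [Enc α] {f g : α → ℕ} (hf : TC B f)
    (hg : TC B g) : TC B (fun a => f a + g a) := by
  obtain ⟨bf, hbf, hbf'⟩ := out_size hf
  obtain ⟨bg, hbg, hbg'⟩ := out_size hg
  have key : ∀ m n : ℕ, (fun x => x + 1)^[n] m = m + n := by
    intro m n
    induction n with
    | zero => rfl
    | succ n ih => rw [Function.iterate_succ_apply', ih]; omega
  convert iterate (F := fun _ x => x + 1) hg hf (succ snd) (BoundClass.add_mem _ hbf _ hbg) ?_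
    using 2 with a
  · rw [key]
  · intro a i hi
    rw [key]
    have h1 := hbf' a
    have h2 := hbg' a
    simp only [esize_nat] at *
    omega

/-- Codes of instances of Token Sliding: adjacency matrix, number of tokens, source, target. -/
abbrev TSCode := List (List Bool) × ℕ × List Bool × List Bool × Unit

namespace TSCode

variable (c : TSCode)

/-- Adjacency test. -/
def adjB (i j : ℕ) : Bool := (c.1.getD i []).getD j false

/-- Membership in the source. -/
def srcB (i : ℕ) : Bool := c.2.2.1.getD i false

/-- Membership in the target. -/
def tgtB (i : ℕ) : Bool := c.2.2.2.1.getD i false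

/-- The list of all vertices. -/
def verts : List ℕ := List.range c.1.length

/-- The parameter `L` for which components are tested to be deep. -/
def depth : ℕ := c.2.1 + c.2.1 + 5

/-- The ball of radius `i` around the source and the target. -/
def ballL (i : ℕ) : List ℕ :=
  iterImage (fun u v => decide (u = v) || adjB c u v) (verts c) i
    ((verts c).filter fun v => srcB c v || tgtB c v)

/-- Membership in a ball. -/
def inBall (i v : ℕ) : Bool := (ballL c i).any fun u => decide (u = v)

/-- The component of `v` outside the ball of radius `2`. -/
def compL (v : ℕ) : List ℕ :=
  iterImage (fun u w => decide (u = w) || (adjB c u w && (!inBall c 2 u && !inBall c 2 w)))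
    (verts c) c.1.length [v]

/-- The test for being deep. -/
def deepB (v : ℕ) : Bool :=
  (compL c v).any fun w => inBall c (depth c + 1) w && !inBall c (depth c) w

/-- The test for being contracted to the same vertex. -/
def mergedB (u v : ℕ) : Bool :=
  decide (u = v) || (deepB c u && (compL c u).any fun w => decide (w = v))

/-- The test for being a representative. -/
def keptB (v : ℕ) : Bool :=
  inBall c (depth c + 1) v &&
    !(verts c).any fun u => decide (u + 1 ≤ v) && (inBall c (depth c + 1) u && mergedB c u v)

/-- The list of representatives. -/
def reps : List ℕ := (verts c).filter (keptB c)

/-- Adjacency of representatives in the contracted graph. -/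
def edgeB (a b : ℕ) : Bool :=
  (!decide (a = b)) && (verts c).any fun u => mergedB c a u &&
    (verts c).any fun v => mergedB c b v && adjB c u v

/-- The code of the galactic instance. -/
def kernelCode : List (List Bool) × List Bool × ℕ × List ℕ × List ℕ × Unit :=
  ((reps c).map fun a => (reps c).map fun b => edgeB c a b, (reps c).map (deepB c), c.2.1,
    (reps c).map fun a => if srcB c a then 1 else 0,
    (reps c).map fun a => if tgtB c a then 1 else 0, ())

section Programs

open TC

variable {B : Set (ℕ → ℕ)} [BoundClass B] {α : Type} [Enc α] {c : α → TSCode} {i j : α → ℕ}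

theorem tc_adjB (hc : TC B c) (hi : TC B i) (hj : TC B j) :
    TC B (fun a => adjB (c a) (i a) (j a)) :=
  getD (getD (fst.comp hc) hi (const [])) hj (const false)

theorem tc_srcB (hc : TC B c) (hi : TC B i) : TC B (fun a => srcB (c a) (i a)) :=
  getD (fst.comp (snd.comp (snd.comp hc))) hi (const false)

theorem tc_tgtB (hc : TC B c) (hi : TC B i) : TC B (fun a => tgtB (c a) (i a)) :=
  getD (fst.comp (snd.comp (snd.comp (snd.comp hc)))) hi (const false)

theorem tc_verts (hc : TC B c) : TC B (fun a => verts (c a)) :=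
  range (length (fst.comp hc))

theorem tc_depth (hc : TC B c) : TC B (fun a => depth (c a)) :=
  add (add (fst.comp (snd.comp hc)) (fst.comp (snd.comp hc))) (const 5)

theorem tc_ballL (hc : TC B c) (hi : TC B i) : TC B (fun a => ballL (c a) (i a)) :=
  TC.iterImage (R := fun a u v => decide (u = v) || adjB (c a) u v)
    (or (natEq (fst.comp snd) (snd.comp snd))
      (tc_adjB (hc.comp fst) (fst.comp snd) (snd.comp snd)))
    (tc_verts hc) hi
    (filter (p := fun a v => srcB (c a) v || tgtB (c a) v) (tc_verts hc)
      (or (tc_srcB (hc.comp fst) snd) (tc_tgtB (hc.comp fst) snd)))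

theorem tc_inBall (hc : TC B c) (hi : TC B i) (hj : TC B j) :
    TC B (fun a => inBall (c a) (i a) (j a)) :=
  any (p := fun a u => decide (u = j a)) (tc_ballL hc hi) (natEq snd (hj.comp fst))

theorem tc_compL (hc : TC B c) (hj : TC B j) : TC B (fun a => compL (c a) (j a)) :=
  TC.iterImage (R := fun a u w => decide (u = w) ||
      (adjB (c a) u w && (!inBall (c a) 2 u && !inBall (c a) 2 w)))
    (or (natEq (fst.comp snd) (snd.comp snd))
      (and (tc_adjB (hc.comp fst) (fst.comp snd) (snd.comp snd))
        (and (not (tc_inBall (hc.comp fst) (const 2) (fst.comp snd)))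
          (not (tc_inBall (hc.comp fst) (const 2) (snd.comp snd))))))
    (tc_verts hc) (length (fst.comp hc)) (cons hj (const []))

theorem tc_deepB (hc : TC B c) (hj : TC B j) : TC B (fun a => deepB (c a) (j a)) :=
  any (p := fun a w => inBall (c a) (depth (c a) + 1) w && !inBall (c a) (depth (c a)) w)
    (tc_compL hc hj)
    (and (tc_inBall (hc.comp fst) (succ (tc_depth (hc.comp fst))) snd)
      (not (tc_inBall (hc.comp fst) (tc_depth (hc.comp fst)) snd)))

theorem tc_mergedB (hc : TC B c) (hi : TC B i) (hj : TC B j) :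
    TC B (fun a => mergedB (c a) (i a) (j a)) :=
  or (natEq hi hj) (and (tc_deepB hc hi)
    (any (p := fun a w => decide (w = j a)) (tc_compL hc hi) (natEq snd (hj.comp fst))))

theorem tc_keptB (hc : TC B c) (hj : TC B j) : TC B (fun a => keptB (c a) (j a)) :=
  and (tc_inBall hc (succ (tc_depth hc)) hj)
    (not (any (p := fun a u => decide (u + 1 ≤ j a) &&
        (inBall (c a) (depth (c a) + 1) u && mergedB (c a) u (j a))) (tc_verts hc)
      (and (natLe (succ snd) (hj.comp fst))
        (and (tc_inBall (hc.comp fst) (succ (tc_depth (hc.comp fst))) snd)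
          (tc_mergedB (hc.comp fst) snd (hj.comp fst))))))

theorem tc_reps (hc : TC B c) : TC B (fun a => reps (c a)) :=
  filter (p := fun a v => keptB (c a) v) (tc_verts hc) (tc_keptB (hc.comp fst) snd)

theorem tc_edgeB (hc : TC B c) (hi : TC B i) (hj : TC B j) :
    TC B (fun a => edgeB (c a) (i a) (j a)) :=
  and (not (natEq hi hj)) (any (p := fun a u => mergedB (c a) (i a) u &&
      (verts (c a)).any fun v => mergedB (c a) (j a) v && adjB (c a) u v) (tc_verts hc)
    (and (tc_mergedB (hc.comp fst) (hi.comp fst) snd)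
      (any (p := fun (x : α × ℕ) v => mergedB (c x.1) (j x.1) v && adjB (c x.1) x.2 v)
        (tc_verts (hc.comp fst))
        (and (tc_mergedB (hc.comp (fst.comp fst)) (hj.comp (fst.comp fst)) snd)
          (tc_adjB (hc.comp (fst.comp fst)) (snd.comp fst) snd)))))

theorem tc_kernelCode : TC B kernelCode :=
  pair (map (g := fun c a => (reps c).map fun b => edgeB c a b) (tc_reps id)
      (map (g := fun (x : TSCode × ℕ) b => edgeB x.1 x.2 b) (tc_reps fst)
        (tc_edgeB (fst.comp fst) (snd.comp fst) snd)))
    (pair (map (g := fun c a => deepB c a) (tc_reps id) (tc_deepB fst snd))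
      (pair (fst.comp snd)
        (pair (map (g := fun c a => if srcB c a then 1 else 0) (tc_reps id)
            (ite (tc_srcB fst snd) (const 1) (const 0)))
          (pair (map (g := fun c a => if tgtB c a then 1 else 0) (tc_reps id)
              (ite (tc_tgtB fst snd) (const 1) (const 0)))
            (const ())))))

end Programs

end TSCode

/-! ### Correctness of the program for the kernel -/

theorem enc_ofFn {α : Type} [Enc α] {n : ℕ} (f : Fin n → α) :
    enc (List.ofFn f) = SExp.ofList (List.ofFn fun i => enc (f i)) := by
  change SExp.ofList ((List.ofFn f).map enc) = _
  rw [List.map_ofFn]; rfl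

theorem ofFn_getElem_eq_map {α β : Type} (l : List α) (f : α → β) :
    (List.ofFn fun i : Fin l.length => f l[i]) = l.map f := by
  refine List.ext_getElem (by simp) fun i h1 h2 => ?_
  simp

theorem ofFn_getD {α : Type} {n : ℕ} (f : Fin n → α) (i : Fin n) (d : α) :
    (List.ofFn f).getD i d = f i := by
  rw [List.getD_eq_getElem _ _ (by simp)]
  simp

theorem any_range_iff {n : ℕ} {p : ℕ → Bool} :
    (List.range n).any p = true ↔ ∃ u : Fin n, p u = true := by
  rw [List.any_eq_true]
  constructor
  · rintro ⟨u, hu, h⟩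
    exact ⟨⟨u, List.mem_range.1 hu⟩, h⟩
  · rintro ⟨u, h⟩
    exact ⟨u, List.mem_range.2 u.2, h⟩

/-- Reachability in a finite graph on `Fin n`, computed by iterated images. -/
theorem mem_iterImage_range_iff {n : ℕ} {r : Fin n → Fin n → Prop} {R : ℕ → ℕ → Bool}
    (hR : ∀ u v : Fin n, R u v = true ↔ u = v ∨ r u v) {v : Fin n} {w : ℕ} :
    w ∈ iterImage R (List.range n) n [(v : ℕ)] ↔
      ∃ hw : w < n, Relation.ReflTransGen r v ⟨w, hw⟩ := by
  rw [mem_iterImage_iff (fun x hx => (hR ⟨x, List.mem_range.1 hx⟩ ⟨x, _⟩).2 (Or.inl rfl))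
    (by simp) (by simp)]
  simp only [List.mem_singleton, exists_eq_left, List.mem_range]
  constructor
  · intro h
    induction h with
    | refl => exact ⟨v.2, .refl⟩
    | tail _ h ih =>
      obtain ⟨hb, ih⟩ := ih
      refine ⟨h.2, ?_⟩
      rcases (hR ⟨_, hb⟩ ⟨_, h.2⟩).1 h.1 with he | he
      · rw [← he]; exact ih
      · exact ih.tail he
  · rintro ⟨hw, h⟩
    have h' : Relation.ReflTransGen (fun a b => R a b = true ∧ b < n) (v : ℕ)
        ((⟨w, hw⟩ : Fin n) : ℕ) := by
      generalize (⟨w, hw⟩ : Fin n) = z at h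
      induction h with
      | refl => exact .refl
      | @tail b c _ h ih => exact ih.tail ⟨(hR b c).2 (Or.inr h), c.2⟩
    exact h'

namespace TSInstance

variable (x : TSInstance)

open Classical in
/-- The code of an instance. -/
noncomputable def code : TSCode :=
  (List.ofFn fun i => List.ofFn fun j => decide (x.G.Adj i j), x.k,
    List.ofFn fun i => decide (i ∈ x.source), List.ofFn fun i => decide (i ∈ x.target), ())

theorem encode_eq : tokenSliding.encode x = enc x.code := by
  simp only [tokenSliding, code, encodeGraph, encodeSet, SExp.ofList, enc_pair, enc_ofFn]
  congr!

theorem length_code : x.code.1.length = x.n := by simp [code]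

theorem adjB_code (u v : Fin x.n) : TSCode.adjB x.code u v = true ↔ x.G.Adj u v := by
  simp only [TSCode.adjB, code, ofFn_getD, decide_eq_true_iff]

theorem srcB_code (u : Fin x.n) : TSCode.srcB x.code u = true ↔ u ∈ x.source := by
  rw [TSCode.srcB, code, ofFn_getD, decide_eq_true_iff]

theorem tgtB_code (u : Fin x.n) : TSCode.tgtB x.code u = true ↔ u ∈ x.target := by
  rw [TSCode.tgtB, code, ofFn_getD, decide_eq_true_iff]

theorem verts_code : TSCode.verts x.code = List.range x.n := by
  rw [TSCode.verts, length_code]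

theorem depth_code : TSCode.depth x.code = 2 * x.k + 5 := by
  change x.k + x.k + 5 = _
  omega

theorem mem_ballL_code (i w : ℕ) : w ∈ TSCode.ballL x.code i ↔
    ∃ hw : w < x.n, (⟨w, hw⟩ : Fin x.n) ∈ ball x.G (x.source ∪ x.target) i := by
  rw [TSCode.ballL, verts_code]
  induction i generalizing w with
  | zero =>
    rw [iterImage, Function.iterate_zero_apply, List.mem_filter, List.mem_range]
    constructor
    · rintro ⟨hw, h⟩
      refine ⟨hw, Finset.mem_union.2 ?_⟩
      have h1 := x.srcB_code ⟨w, hw⟩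
      have h2 := x.tgtB_code ⟨w, hw⟩
      rwa [Bool.or_eq_true, h1, h2] at h
    · rintro ⟨hw, h⟩
      have h1 := x.srcB_code ⟨w, hw⟩
      have h2 := x.tgtB_code ⟨w, hw⟩
      refine ⟨hw, ?_⟩
      rw [Bool.or_eq_true, h1, h2]
      exact Finset.mem_union.1 h
  | succ i ih =>
    rw [mem_iterImage_succ, List.mem_range]
    constructor
    · rintro ⟨hw, y, hy, hyw⟩
      obtain ⟨hy1, hy2⟩ := (ih y).1 hy
      refine ⟨hw, mem_ball_succ.2 ⟨_, hy2, ?_⟩⟩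
      rw [← x.adjB_code]
      simpa [Fin.ext_iff] using hyw
    · rintro ⟨hw, h⟩
      obtain ⟨u, hu, hu'⟩ := mem_ball_succ.1 h
      refine ⟨hw, u, (ih u).2 ⟨u.2, hu⟩, ?_⟩
      rw [← x.adjB_code] at hu'
      simpa [Fin.ext_iff] using hu'

theorem inBall_code (i : ℕ) (v : Fin x.n) :
    TSCode.inBall x.code i v = true ↔ v ∈ ball x.G (x.source ∪ x.target) i := by
  simp only [TSCode.inBall, List.any_eq_true, mem_ballL_code, decide_eq_true_iff]
  constructor
  · rintro ⟨u, ⟨hu, hu'⟩, rfl⟩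
    exact hu'
  · exact fun h => ⟨v, ⟨v.2, h⟩, rfl⟩

theorem mem_compL_code (v : Fin x.n) (w : ℕ) : w ∈ TSCode.compL x.code v ↔
    ∃ hw : w < x.n, OuterConn x.G (x.source ∪ x.target) v ⟨w, hw⟩ := by
  rw [TSCode.compL, verts_code, length_code]
  refine mem_iterImage_range_iff fun u v => ?_
  rw [Bool.or_eq_true, Bool.and_eq_true, Bool.and_eq_true, Bool.not_eq_true', Bool.not_eq_true',
    ← Bool.not_eq_true, ← Bool.not_eq_true, adjB_code, inBall_code, inBall_code,
    decide_eq_true_iff, Fin.ext_iff]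

theorem deepB_code (v : Fin x.n) :
    TSCode.deepB x.code v = true ↔ Deep x.G (x.source ∪ x.target) (2 * x.k + 5) v := by
  simp only [TSCode.deepB, List.any_eq_true, mem_compL_code, depth_code, Bool.and_eq_true,
    Bool.not_eq_true', ← Bool.not_eq_true]
  constructor
  · rintro ⟨w, ⟨hw, h⟩, h1, h2⟩
    exact ⟨⟨w, hw⟩, (x.inBall_code _ ⟨w, hw⟩).1 h1, fun h => h2 ((x.inBall_code _ ⟨w, hw⟩).2 h), h⟩
  · rintro ⟨w, h1, h2, h⟩
    exact ⟨w, ⟨w.2, h⟩, (x.inBall_code _ w).2 h1, fun h => h2 ((x.inBall_code _ w).1 h)⟩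

theorem mergedB_code (u v : Fin x.n) :
    TSCode.mergedB x.code u v = true ↔ Merged x.G (x.source ∪ x.target) (2 * x.k + 5) u v := by
  rw [TSCode.mergedB, Bool.or_eq_true, Bool.and_eq_true, deepB_code, decide_eq_true_iff, Merged,
    Fin.ext_iff]
  refine or_congr Iff.rfl (and_congr Iff.rfl ?_)
  simp only [List.any_eq_true, mem_compL_code, decide_eq_true_iff]
  constructor
  · rintro ⟨w, ⟨hw, h⟩, rfl⟩
    exact h
  · exact fun h => ⟨v, ⟨v.2, h⟩, rfl⟩

theorem keptB_code (v : Fin x.n) :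
    TSCode.keptB x.code v = true ↔ Kept x.G (x.source ∪ x.target) (2 * x.k + 5) v := by
  rw [TSCode.keptB, Bool.and_eq_true, Bool.not_eq_true', ← Bool.not_eq_true, verts_code,
    any_range_iff, depth_code, inBall_code, Kept]
  refine and_congr Iff.rfl ?_
  push Not
  refine forall_congr' fun u => ?_
  rw [Ne, Bool.and_eq_true, Bool.and_eq_true, inBall_code, mergedB_code, decide_eq_true_iff,
    Nat.succ_le_iff, ← Fin.lt_def]
  tauto

theorem reps_code : TSCode.reps x.code =
    (kernelReps x.G (x.source ∪ x.target) x.k).map Fin.val := by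
  classical
  rw [TSCode.reps, verts_code, kernelReps, ← List.map_coe_finRange_eq_range, List.filter_map]
  congr 1
  refine List.filter_congr fun v _ => ?_
  rw [Bool.eq_iff_iff, decide_eq_true_iff]
  exact x.keptB_code v

theorem edgeB_code (a b : Fin (kernelReps x.G (x.source ∪ x.target) x.k).length) :
    TSCode.edgeB x.code (kernelRep x.G (x.source ∪ x.target) x.k a)
      (kernelRep x.G (x.source ∪ x.target) x.k b) = true ↔
      (kernelGraph x.G (x.source ∪ x.target) x.k).Adj a b := by
  rw [TSCode.edgeB, Bool.and_eq_true, Bool.not_eq_true', decide_eq_false_iff_not, verts_code,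
    any_range_iff, ← Fin.ext_iff, kernelRep_injective.eq_iff]
  simp only [Bool.and_eq_true, any_range_iff, mergedB_code, adjB_code]
  refine and_congr Iff.rfl (exists_congr fun u => ?_)
  exact ⟨fun ⟨h1, v, h2, h3⟩ => ⟨v, h1, h2, h3⟩, fun ⟨v, h1, h2, h3⟩ => ⟨h1, v, h2, h3⟩⟩

theorem enc_map_reps {β : Type} [Enc β] (f : ℕ → β) :
    enc ((TSCode.reps x.code).map f) = SExp.ofList (List.ofFn fun a =>
      enc (f (kernelRep x.G (x.source ∪ x.target) x.k a))) := by
  rw [reps_code, List.map_map, ← ofFn_getElem_eq_map, enc_ofFn]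
  rfl

theorem encode_kernel :
    galacticTokenSliding.encode (kernel x) = enc (TSCode.kernelCode x.code) := by
  simp only [galacticTokenSliding, TSCode.kernelCode, encodeGraph, encodeSet, encodeWeights,
    SExp.ofList, enc_pair, enc_map_reps]
  have hbool : ∀ (p : Prop) {_ : Decidable p} (b : Bool), (b = true ↔ p) →
      SExp.ofBool (decide p) = enc b := by
    intro p _ b h
    have hb : decide p = b := by rw [Bool.eq_iff_iff, decide_eq_true_iff, h]
    rw [hb]; rfl
  have hweight : ∀ (I : Finset (Fin x.n)) (hI : I ⊆ x.source ∪ x.target) (p : ℕ → Bool)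
      (hp : ∀ u : Fin x.n, p u = true ↔ u ∈ I) a,
      SExp.ofNat (Contraction.project (KernelCls x.G (x.source ∪ x.target) x.k) I a) =
        enc (if p (kernelRep x.G (x.source ∪ x.target) x.k a) = true then 1 else 0) := by
    intro I hI p hp a
    rw [project_kernelCls hI]
    simp only [hp]
    rfl
  refine congrArg₂ SExp.node (congrArg SExp.ofList (congrArg List.ofFn (funext fun a =>
      congrArg SExp.ofList (congrArg List.ofFn (funext fun b => ?_)))))
    (congrArg₂ SExp.node (congrArg SExp.ofList (congrArg List.ofFn (funext fun a => ?_)))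
    (congrArg₂ SExp.node rfl
    (congrArg₂ SExp.node (congrArg SExp.ofList (congrArg List.ofFn (funext fun a => ?_)))
    (congrArg₂ SExp.node (congrArg SExp.ofList (congrArg List.ofFn (funext fun a => ?_))) rfl))))
  · exact hbool _ _ (x.edgeB_code a b)
  · exact hbool _ _ ((x.deepB_code _).trans mem_kernelHoles.symm)
  · exact hweight _ Finset.subset_union_left _ x.srcB_code a
  · exact hweight _ Finset.subset_union_right _ x.tgtB_code a

end TSInstance

/-! ### Exhaustive search for Galactic Token Sliding -/

/-- Codes of instances of Galactic Token Sliding: adjacency matrix, black holes, number of tokens,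
source, target. -/
abbrev GalacticCode := List (List Bool) × List Bool × ℕ × List ℕ × List ℕ × Unit

/-- All lists of length `n` with entries at most `k`. -/
def weightLists (k n : ℕ) : List (List ℕ) :=
  (fun X : List (List ℕ) => X.flatMap fun l => (List.range (k + 1)).map fun c => c :: l)^[n] [[]]

theorem weightLists_succ (k n : ℕ) : weightLists k (n + 1) =
    (weightLists k n).flatMap fun l => (List.range (k + 1)).map fun c => c :: l := by
  rw [weightLists, Function.iterate_succ_apply']; rfl

theorem mem_weightLists {k n : ℕ} {l : List ℕ} :
    l ∈ weightLists k n ↔ l.length = n ∧ ∀ c ∈ l, c ≤ k := by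
  induction n generalizing l with
  | zero => simp +contextual [weightLists]
  | succ n ih =>
    rw [weightLists_succ, List.mem_flatMap]
    constructor
    · rintro ⟨l', hl', h⟩
      obtain ⟨c, hc, rfl⟩ := List.mem_map.1 h
      obtain ⟨h1, h2⟩ := ih.1 hl'
      rw [List.mem_range] at hc
      simp only [List.length_cons, h1, List.mem_cons, forall_eq_or_imp, true_and]
      exact ⟨by omega, h2⟩
    · rintro ⟨h1, h2⟩
      cases l with
      | nil => simp at h1
      | cons c l =>
        simp only [List.mem_cons, forall_eq_or_imp] at h2
        exact ⟨l, ih.2 ⟨by simpa using h1, h2.2⟩, List.mem_map.2 ⟨c, by simp; omega, rfl⟩⟩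

theorem length_weightLists (k n : ℕ) : (weightLists k n).length = (k + 1) ^ n := by
  induction n with
  | zero => rfl
  | succ n ih => simp [weightLists_succ, List.length_flatMap, ih, pow_succ]

theorem esize_weightLists_le (k n N : ℕ) (hk : k ≤ N) (hn : n ≤ N) :
    esize (weightLists k n) ≤ (N + 1) ^ N * (N * (2 * N + 2) + 2) + 1 := by
  refine (esize_le_of_forall _ (N * (2 * N + 2) + 1) fun l hl => ?_).trans ?_
  · obtain ⟨h1, h2⟩ := mem_weightLists.1 hl
    refine (esize_le_of_forall l (2 * N + 1) fun c hc => ?_).trans ?_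
    · have := h2 c hc
      rw [esize_nat]; omega
    · rw [h1]; gcongr
  · rw [length_weightLists]
    have : (k + 1) ^ n ≤ (N + 1) ^ N :=
      (Nat.pow_le_pow_left (Nat.succ_le_succ hk) n).trans (Nat.pow_le_pow_right (Nat.succ_pos _) hn)
    exact Nat.succ_le_succ (Nat.mul_le_mul_right _ this)

theorem TC.weightLists {α : Type} [Enc α] {k n : α → ℕ} (hk : TC CompBd k) (hn : TC CompBd n) :
    TC CompBd (fun a => TokenSliding.weightLists (k a) (n a)) := by
  obtain ⟨bk, hbk, hbk'⟩ := out_size hk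
  obtain ⟨bn, hbn, hbn'⟩ := out_size hn
  have hN : (fun s => bk s + bn s) ∈ CompBd := BoundClass.add_mem _ hbk _ hbn
  have hb : (fun s => (bk s + bn s + 1) ^ (bk s + bn s) *
      ((bk s + bn s) * (2 * (bk s + bn s) + 2) + 2) + 1) ∈ CompBd :=
    BoundClass.add_mem _ (BoundClass.mul_mem _ (compBd_pow hN hN) _
      (BoundClass.comp_mem (fun s => s * (2 * s + 2) + 2) (BoundClass.add_mem _
        (BoundClass.mul_mem _ BoundClass.id_mem _ (TC.linear_mem 2 2)) _
          (BoundClass.const_mem 2)) _ hN)) _ (BoundClass.const_mem 1)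
  refine iterate (F := fun a X => X.flatMap fun l => (List.range (k a + 1)).map fun c => c :: l)
    hn (const [[]]) (flatMap (g := fun (x : α × List (List ℕ)) l =>
        (List.range (k x.1 + 1)).map fun c => c :: l) snd
      (map (g := fun (x : (α × List (List ℕ)) × List ℕ) c => c :: x.2)
        (range (succ (hk.comp (fst.comp fst)))) (cons snd (snd.comp fst)))) hb fun a i hi => ?_
  have h1 := hbk' a
  have h2 := hbn' a
  simp only [esize_nat] at h1 h2
  exact esize_weightLists_le (k a) i _ (by omega) (by omega)

namespace GalacticCode

variable (g : GalacticCode)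

/-- Adjacency test. -/
def adjB (i j : ℕ) : Bool := (g.1.getD i []).getD j false

/-- The test for black holes. -/
def holeB (i : ℕ) : Bool := g.2.1.getD i false

/-- The list of all vertices. -/
def verts : List ℕ := List.range g.1.length

/-- The conditions on planets in the definition of a galactic independent set. -/
def indepB (w : List ℕ) : Bool :=
  ((verts g).all fun v => holeB g v || decide (w.getD v 0 ≤ 1)) &&
    (verts g).all fun u => (verts g).all fun v => holeB g u || (holeB g v ||
      ((!adjB g u v) || (decide (w.getD u 0 = 0) || decide (w.getD v 0 = 0))))

/-- Equality of weights. -/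
def eqB (w w' : List ℕ) : Bool := (verts g).all fun v => decide (w.getD v 0 = w'.getD v 0)

/-- The test for moving a token from `u` to `v`. -/
def moveB (w w' : List ℕ) (u v : ℕ) : Bool :=
  (verts g).all fun i => decide (w'.getD i 0 + (if decide (i = u) then 1 else 0) =
    w.getD i 0 + (if decide (i = v) then 1 else 0))

/-- The test for equality or a galactic slide. -/
def stepB (w w' : List ℕ) : Bool :=
  eqB g w w' || (indepB g w && (indepB g w' &&
    (verts g).any fun u => (verts g).any fun v => adjB g u v && moveB g w w' u v))

/-- All candidates for weight functions. -/
def univL : List (List ℕ) := weightLists g.2.2.1 g.1.length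

/-- The answer, computed by exhaustive search. -/
def decideB : Bool :=
  (iterImage (stepB g) (univL g) (univL g).length [g.2.2.2.1]).any fun w => eqB g w g.2.2.2.2.1

section Programs

open TC

variable {B : Set (ℕ → ℕ)} [BoundClass B] {α : Type} [Enc α] {g : α → GalacticCode}
  {i j : α → ℕ} {w w' : α → List ℕ}

theorem tc_adjB (hg : TC B g) (hi : TC B i) (hj : TC B j) :
    TC B (fun a => adjB (g a) (i a) (j a)) :=
  getD (getD (fst.comp hg) hi (const [])) hj (const false)

theorem tc_holeB (hg : TC B g) (hi : TC B i) : TC B (fun a => holeB (g a) (i a)) :=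
  getD (fst.comp (snd.comp hg)) hi (const false)

theorem tc_verts (hg : TC B g) : TC B (fun a => verts (g a)) :=
  range (length (fst.comp hg))

theorem tc_weight (hw : TC B w) (hi : TC B i) : TC B (fun a => (w a).getD (i a) 0) :=
  getD hw hi (const 0)

theorem tc_indepB (hg : TC B g) (hw : TC B w) : TC B (fun a => indepB (g a) (w a)) :=
  and (all (p := fun a v => holeB (g a) v || decide ((w a).getD v 0 ≤ 1)) (tc_verts hg)
      (or (tc_holeB (hg.comp fst) snd) (natLe (tc_weight (hw.comp fst) snd) (const 1))))
    (all (p := fun a u => (verts (g a)).all fun v => holeB (g a) u || (holeB (g a) v ||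
        ((!adjB (g a) u v) || (decide ((w a).getD u 0 = 0) || decide ((w a).getD v 0 = 0)))))
      (tc_verts hg)
      (all (p := fun (x : α × ℕ) v => holeB (g x.1) x.2 || (holeB (g x.1) v ||
          ((!adjB (g x.1) x.2 v) ||
            (decide ((w x.1).getD x.2 0 = 0) || decide ((w x.1).getD v 0 = 0)))))
        (tc_verts (hg.comp fst))
        (or (tc_holeB (hg.comp (fst.comp fst)) (snd.comp fst))
          (or (tc_holeB (hg.comp (fst.comp fst)) snd)
            (or (not (tc_adjB (hg.comp (fst.comp fst)) (snd.comp fst) snd))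
              (or (isZero (tc_weight (hw.comp (fst.comp fst)) (snd.comp fst)))
                (isZero (tc_weight (hw.comp (fst.comp fst)) snd))))))))

theorem tc_eqB (hg : TC B g) (hw : TC B w) (hw' : TC B w') :
    TC B (fun a => eqB (g a) (w a) (w' a)) :=
  all (p := fun a v => decide ((w a).getD v 0 = (w' a).getD v 0)) (tc_verts hg)
    (natEq (tc_weight (hw.comp fst) snd) (tc_weight (hw'.comp fst) snd))

theorem tc_moveB (hg : TC B g) (hw : TC B w) (hw' : TC B w') (hi : TC B i) (hj : TC B j) :
    TC B (fun a => moveB (g a) (w a) (w' a) (i a) (j a)) :=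
  all (p := fun a l => decide ((w' a).getD l 0 + (if decide (l = i a) then 1 else 0) =
      (w a).getD l 0 + (if decide (l = j a) then 1 else 0))) (tc_verts hg)
    (natEq
      (add (tc_weight (hw'.comp fst) snd) (ite (natEq snd (hi.comp fst)) (const 1) (const 0)))
      (add (tc_weight (hw.comp fst) snd) (ite (natEq snd (hj.comp fst)) (const 1) (const 0))))

theorem tc_stepB (hg : TC B g) (hw : TC B w) (hw' : TC B w') :
    TC B (fun a => stepB (g a) (w a) (w' a)) :=
  or (tc_eqB hg hw hw') (and (tc_indepB hg hw) (and (tc_indepB hg hw')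
    (any (p := fun a u => (verts (g a)).any fun v =>
        adjB (g a) u v && moveB (g a) (w a) (w' a) u v)
      (tc_verts hg)
      (any (p := fun (x : α × ℕ) v => adjB (g x.1) x.2 v && moveB (g x.1) (w x.1) (w' x.1) x.2 v)
        (tc_verts (hg.comp fst))
        (and (tc_adjB (hg.comp (fst.comp fst)) (snd.comp fst) snd)
          (tc_moveB (hg.comp (fst.comp fst)) (hw.comp (fst.comp fst)) (hw'.comp (fst.comp fst))
            (snd.comp fst) snd))))))

theorem tc_decideB : TC CompBd decideB :=
  have hu : TC CompBd univL := TC.weightLists (fst.comp (snd.comp snd)) (length fst)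
  any (p := fun g w => eqB g w g.2.2.2.2.1)
    (TC.iterImage (R := stepB) (tc_stepB fst (fst.comp snd) (snd.comp snd)) hu (length hu)
      (cons (fst.comp (snd.comp (snd.comp snd))) (const [])))
    (tc_eqB fst snd (fst.comp (snd.comp (snd.comp (snd.comp (snd.comp fst))))))

end Programs

end GalacticCode

theorem all_range_iff {n : ℕ} {p : ℕ → Bool} :
    (List.range n).all p = true ↔ ∀ u : Fin n, p u = true := by
  rw [List.all_eq_true]
  exact ⟨fun h u => h u (List.mem_range.2 u.2), fun h u hu => h ⟨u, List.mem_range.1 hu⟩⟩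

namespace GalacticInstance

variable (x : GalacticInstance)

open Classical in
/-- The code of an instance. -/
noncomputable def code : GalacticCode :=
  (List.ofFn fun i => List.ofFn fun j => decide (x.G.Adj i j),
    List.ofFn fun i => decide (i ∈ x.blackHoles), x.k, List.ofFn x.source, List.ofFn x.target, ())

theorem encode_eq : galacticTokenSliding.encode x = enc x.code := by
  simp only [galacticTokenSliding, code, encodeGraph, encodeSet, encodeWeights, SExp.ofList,
    enc_pair, enc_ofFn]
  congr!

theorem verts_code : GalacticCode.verts x.code = List.range x.n := by
  simp [GalacticCode.verts, code]

theorem adjB_code (u v : Fin x.n) : GalacticCode.adjB x.code u v = true ↔ x.G.Adj u v := by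
  simp only [GalacticCode.adjB, code, ofFn_getD, decide_eq_true_iff]

theorem holeB_code (u : Fin x.n) : GalacticCode.holeB x.code u = true ↔ u ∈ x.blackHoles := by
  simp only [GalacticCode.holeB, code, ofFn_getD, decide_eq_true_iff]

theorem indepB_code (w : Fin x.n → ℕ) : GalacticCode.indepB x.code (List.ofFn w) = true ↔
    (∀ v, v ∉ x.blackHoles → w v ≤ 1) ∧
      ∀ u v, u ∉ x.blackHoles → v ∉ x.blackHoles → x.G.Adj u v → w u = 0 ∨ w v = 0 := by
  simp only [GalacticCode.indepB, verts_code, Bool.and_eq_true, all_range_iff, Bool.or_eq_true,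
    holeB_code, Bool.not_eq_true', ← Bool.not_eq_true, adjB_code, ofFn_getD, decide_eq_true_iff,
    imp_iff_not_or, not_not]

theorem isGalacticIndep_iff (w : Fin x.n → ℕ) : IsGalacticIndep x.G x.blackHoles x.k w ↔
    GalacticCode.indepB x.code (List.ofFn w) = true ∧ ∑ v, w v = x.k := by
  rw [indepB_code]
  exact ⟨fun h => ⟨⟨h.1, h.2⟩, h.3⟩, fun h => ⟨h.1.1, h.1.2, h.2⟩⟩

theorem eqB_code (w w' : Fin x.n → ℕ) :
    GalacticCode.eqB x.code (List.ofFn w) (List.ofFn w') = true ↔ w = w' := by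
  simp only [GalacticCode.eqB, verts_code, all_range_iff, ofFn_getD, decide_eq_true_iff,
    funext_iff]

theorem moveB_code (w w' : Fin x.n → ℕ) (u v : Fin x.n) :
    GalacticCode.moveB x.code (List.ofFn w) (List.ofFn w') u v = true ↔
      w' + Pi.single u 1 = w + Pi.single v 1 := by
  simp only [GalacticCode.moveB, verts_code, all_range_iff, ofFn_getD, decide_eq_true_iff,
    funext_iff, Pi.add_apply, Pi.single_apply, ← Fin.ext_iff]

theorem stepB_code (w w' : Fin x.n → ℕ) :
    GalacticCode.stepB x.code (List.ofFn w) (List.ofFn w') = true ↔ w = w' ∨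
      GalacticCode.indepB x.code (List.ofFn w) = true ∧
      GalacticCode.indepB x.code (List.ofFn w') = true ∧
      ∃ u v, x.G.Adj u v ∧ w' + Pi.single u 1 = w + Pi.single v 1 := by
  rw [GalacticCode.stepB, Bool.or_eq_true, eqB_code, Bool.and_eq_true, Bool.and_eq_true,
    verts_code]
  simp only [any_range_iff, Bool.and_eq_true, adjB_code, moveB_code]

theorem mem_univL_code {w : Fin x.n → ℕ} (h : ∑ v, w v = x.k) :
    List.ofFn w ∈ GalacticCode.univL x.code := by
  refine mem_weightLists.2 ⟨by simp [code], fun c hc => ?_⟩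
  obtain ⟨v, rfl⟩ := (List.mem_ofFn' _ _).1 hc
  rw [← show ∑ v, w v = x.code.2.2.1 from h]
  exact Finset.single_le_sum (fun _ _ => Nat.zero_le _) (Finset.mem_univ v)

theorem decideB_code : GalacticCode.decideB x.code = true ↔ galacticTokenSliding.IsYes x := by
  have hex : ∀ l ∈ GalacticCode.univL x.code, ∃ w : Fin x.n → ℕ, l = List.ofFn w := by
    intro l hl
    have hlen : l.length = x.n := by
      rw [(mem_weightLists.1 hl).1]; simp [code]
    refine ⟨fun i => l[i], List.ext_getElem (by simp [hlen]) fun i _ _ => by simp⟩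
  have hrefl : ∀ l ∈ GalacticCode.univL x.code, GalacticCode.stepB x.code l l = true := by
    intro l hl
    obtain ⟨w, rfl⟩ := hex l hl
    exact (x.stepB_code w w).2 (Or.inl rfl)
  have hs := x.mem_univL_code x.source_indep.total
  rw [GalacticCode.decideB, List.any_eq_true]
  have hmem := fun l => mem_iterImage_iff (x := l) (R := GalacticCode.stepB x.code)
    (init := [x.code.2.2.2.1]) hrefl (fun l hl => by rw [List.mem_singleton.1 hl]; exact hs) le_rfl
  simp only [hmem, List.mem_singleton, exists_eq_left]
  change (∃ l, Relation.ReflTransGen _ (List.ofFn x.source) l ∧ _) ↔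
    Relation.ReflTransGen _ x.source x.target
  constructor
  · rintro ⟨l, hl, ht⟩
    have key : ∃ w, l = List.ofFn w ∧ ∑ v, w v = x.k ∧
        Relation.ReflTransGen (GalacticStep x.G x.blackHoles x.k) x.source w := by
      clear ht
      induction hl with
      | refl => exact ⟨_, rfl, x.source_indep.total, .refl⟩
      | @tail l l' _ h ih =>
        obtain ⟨w, rfl, hsum, hw⟩ := ih
        obtain ⟨w', rfl⟩ := hex l' h.2
        refine ⟨w', rfl, ?_⟩
        rcases (x.stepB_code w w').1 h.1 with rfl | ⟨h1, h2, u, v, huv, hmove⟩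
        · exact ⟨hsum, hw⟩
        · have hsum' : ∑ v, w' v = x.k := by
            have h3 : ∑ a, (w' + Pi.single u 1 : Fin x.n → ℕ) a =
                ∑ a, (w + Pi.single v 1 : Fin x.n → ℕ) a := by rw [hmove]
            simp only [Pi.add_apply, Finset.sum_add_distrib, Finset.sum_pi_single',
              Finset.mem_univ, if_true] at h3
            simpa [hsum] using h3
          exact ⟨hsum', hw.tail ⟨(x.isGalacticIndep_iff w).2 ⟨h1, hsum⟩,
            (x.isGalacticIndep_iff w').2 ⟨h2, hsum'⟩, u, v, huv, hmove⟩⟩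
    obtain ⟨w, rfl, -, hw⟩ := key
    obtain rfl := (x.eqB_code w x.target).1 ht
    exact hw
  · intro h
    refine ⟨List.ofFn x.target, ?_, (x.eqB_code _ _).2 rfl⟩
    generalize x.target = w at h
    induction h with
    | refl => exact .refl
    | tail _ h ih =>
      obtain ⟨h1, h2, h3⟩ := h
      exact ih.tail ⟨(x.stepB_code _ _).2 (Or.inr ⟨((x.isGalacticIndep_iff _).1 h1).1,
        ((x.isGalacticIndep_iff _).1 h2).1, h3⟩), x.mem_univL_code h2.total⟩

/-- The size of an instance, in terms of the numbers of vertices and tokens. -/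
theorem esize_code_le : esize x.code ≤
    x.n * (4 * x.n + 2) + 4 * x.n + 2 * (x.n * (2 * x.k + 2)) + 2 * x.k + 20 := by
  have hofFn : ∀ {β : Type} [Enc β] (f : Fin x.n → β) (K : ℕ) (_ : ∀ i, esize (f i) ≤ K),
      esize (List.ofFn f) ≤ x.n * (K + 1) + 1 := by
    intro β _ f K hf
    refine (esize_le_of_forall _ K fun b hb => ?_).trans (by simp)
    obtain ⟨i, rfl⟩ := (List.mem_ofFn' _ _).1 hb
    exact hf i
  have hw : ∀ w : Fin x.n → ℕ, ∑ v, w v = x.k → esize (List.ofFn w) ≤ x.n * (2 * x.k + 2) + 1 := by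
    intro w hw
    refine hofFn w (2 * x.k + 1) fun i => ?_
    have : w i ≤ ∑ v, w v := Finset.single_le_sum (fun _ _ => Nat.zero_le _) (Finset.mem_univ i)
    rw [esize_nat]; omega
  have h1 := hw _ x.source_indep.total
  have h2 := hw _ x.target_indep.total
  have h3 : esize x.code.2.1 ≤ x.n * (3 + 1) + 1 := hofFn _ 3 fun i => esize_bool_le _
  have h4 : esize x.code.1 ≤ x.n * (x.n * (3 + 1) + 1 + 1) + 1 :=
    hofFn _ _ fun i => hofFn _ 3 fun j => esize_bool_le _
  have h5 : esize x.code = esize x.code.1 + (esize x.code.2.1 + (esize x.k +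
      (esize (List.ofFn x.source) + (esize (List.ofFn x.target) + 1 + 1) + 1) + 1) + 1) + 1 := rfl
  rw [h5, esize_nat]
  rw [show x.n * (3 + 1) + 1 + 1 = 4 * x.n + 2 by ring] at h4
  omega

end GalacticInstance

/-! ### The bikernel and fixed-parameter tractability -/

/-- A bound on the number of vertices of the kernel. -/
def kernelOrder (s : ℕ) : ℕ := 2 * s * (s + 1) ^ (2 * s + 6)

/-- A bound on the size and the parameter of the kernel. -/
def kernelSize (s : ℕ) : ℕ :=
  kernelOrder s * (4 * kernelOrder s + 2) + 4 * kernelOrder s +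
    2 * (kernelOrder s * (2 * s + 2)) + 2 * s + 20

theorem kernelOrder_mem : kernelOrder ∈ CompBd :=
  BoundClass.mul_mem _ (TC.linear_mem 2 0) _ (compBd_pow BoundClass.id_mem (TC.linear_mem 2 6))

theorem kernelSize_mem : kernelSize ∈ CompBd :=
  BoundClass.add_mem _ (BoundClass.add_mem _ (BoundClass.add_mem _ (BoundClass.add_mem _
    (BoundClass.mul_mem _ kernelOrder_mem _
      (BoundClass.comp_mem _ (TC.linear_mem 4 2) _ kernelOrder_mem)) _
    (BoundClass.mul_mem _ (BoundClass.const_mem 4) _ kernelOrder_mem)) _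
    (BoundClass.mul_mem _ (BoundClass.const_mem 2) _
      (BoundClass.mul_mem _ kernelOrder_mem _ (TC.linear_mem 2 2)))) _
    (BoundClass.mul_mem _ (BoundClass.const_mem 2) _ BoundClass.id_mem)) _
    (BoundClass.const_mem 20)

theorem kernel_n_le_order (x : TSInstance) : (kernel x).n ≤ kernelOrder (tokenSliding.param x) := by
  have hk : x.k ≤ tokenSliding.param x := Nat.le_add_right _ _
  have hd : maxDeg x.G ≤ tokenSliding.param x := Nat.le_add_left _ _
  refine (kernel_n_le x).trans ?_
  unfold kernelOrder
  gcongr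
  omega

theorem size_kernel_le (x : TSInstance) :
    (galacticTokenSliding.encode (kernel x)).size ≤ kernelSize (tokenSliding.param x) := by
  rw [GalacticInstance.encode_eq]
  refine (GalacticInstance.esize_code_le _).trans ?_
  have hk : (kernel x).k ≤ tokenSliding.param x := Nat.le_add_right _ _
  have hn := kernel_n_le_order x
  unfold kernelSize
  gcongr

theorem param_kernel_le (x : TSInstance) :
    galacticTokenSliding.param (kernel x) ≤ kernelSize (tokenSliding.param x) := by
  have hk : (kernel x).k ≤ tokenSliding.param x := Nat.le_add_right _ _
  have hn := kernel_n_le_order x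
  have hd : maxDeg (kernel x).G ≤ (kernel x).n := by
    classical
    refine SimpleGraph.maxDegree_le_of_forall_degree_le _ _ fun v => ?_
    simpa using ((kernel x).G.degree_lt_card_verts v).le
  change (kernel x).k + maxDeg (kernel x).G ≤ _
  unfold kernelSize
  omega

theorem kernel_isBikernelization :
    IsBikernelization tokenSliding galacticTokenSliding kernel where
  polytime := by
    obtain ⟨p, b, ⟨q, hq⟩, h⟩ := TSCode.tc_kernelCode (B := PolyBd)
    have key : ∀ x : TSInstance, ∃ t, Runs p (tokenSliding.encode x)
        (galacticTokenSliding.encode (kernel x)) t ∧ t ≤ q.eval (tokenSliding.encode x).size := by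
      intro x
      rw [TSInstance.encode_eq, TSInstance.encode_kernel, ← hq]
      exact h x.code
    exact ⟨p, q, key⟩
  equivalent := kernel_equivalent
  bounded := ⟨kernelSize, kernelSize_mem.2, fun x => ⟨size_kernel_le x, param_kernel_le x⟩⟩

/-- Token Sliding is decided by exhaustive search on the kernel. -/
theorem tokenSliding_isFPT : tokenSliding.IsFPT := by
  obtain ⟨p, q, hp⟩ := kernel_isBikernelization.polytime
  obtain ⟨p', b, hb, hp'⟩ := GalacticCode.tc_decideB
  refine ⟨Prog.seq p p', fun s => b (kernelSize s) + 1, q + 1,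
    (BoundClass.add_mem _ (BoundClass.comp_mem _ hb _ kernelSize_mem) _
      (BoundClass.const_mem 1)).2, fun x => ?_⟩
  obtain ⟨t, ht, hle⟩ := hp x
  obtain ⟨t', ht', hle'⟩ := hp' (kernel x).code
  have hanswer : enc (GalacticCode.decideB (kernel x).code) =
      SExp.ofBool (@decide (tokenSliding.IsYes x) (Classical.propDecidable _)) := by
    have h := ((kernel x).decideB_code).trans (kernel_equivalent x).symm
    rw [← @decide_eq_true_iff (tokenSliding.IsYes x) (Classical.propDecidable _),
      ← Bool.eq_iff_iff] at h
    rw [h]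
    rfl
  rw [GalacticInstance.encode_eq] at ht
  rw [hanswer] at ht'
  refine ⟨_, Runs.seq ht ht', ?_⟩
  have hsize : b (esize (kernel x).code) ≤ b (kernelSize (tokenSliding.param x)) := by
    refine hb.1 ?_
    have := size_kernel_le x
    rwa [GalacticInstance.encode_eq] at this
  rw [Polynomial.eval_add, Polynomial.eval_one]
  nlinarith

end TokenSliding

theorem mainTheorem1 :
    TokenSliding.tokenSliding.IsFPT ∧
    ∃ (c : ℕ) (r : TokenSliding.TSInstance → TokenSliding.GalacticInstance),
      TokenSliding.IsBikernelization
        TokenSliding.tokenSliding TokenSliding.galacticTokenSliding r ∧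
      (∀ x : TokenSliding.TSInstance, 1 ≤ TokenSliding.maxDeg x.G →
        (r x).n ≤ x.k * TokenSliding.maxDeg x.G ^ (c * x.k ^ 2) +
          (2 * x.k + 2 * x.k * TokenSliding.maxDeg x.G) * TokenSliding.maxDeg x.G) ∧
      (∀ x : TokenSliding.TSInstance, (r x).k ≤ x.k) ∧
      (∀ x : TokenSliding.TSInstance, x.G.Connected → 2 ≤ x.k →
        (r x).G.Connected ∧ 2 ≤ (r x).k) := by
  refine ⟨TokenSliding.tokenSliding_isFPT, 17, TokenSliding.kernel,
    TokenSliding.kernel_isBikernelization, TokenSliding.kernel_n_le', fun x => le_rfl,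
    fun x hx hk => ⟨TokenSliding.kernelGraph_connected hx ?_, hk⟩⟩
  have : 0 < x.source.card := by rw [x.source_card]; omega
  exact (Finset.card_pos.1 this).mono Finset.subset_union_left
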